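/- Fix an integer $g\ge 2$ and let $\Gamma_g=\langle a_1,b_1,\dots,a_g,b_g\mid [a_1,b_1]\cdots[a_g,b_g]\rangle$. A ($g$-)\emph{tiled surface} is an at most two-dimensional CW-complex $Y$ whose edges are directed and labeled by $a_1,b_1,\dots,a_g,b_g$ such that (P1) every vertex has at most one incoming and at most one outgoing edge with a given label; (P2) every path in the $1$-skeleton reading a word that is trivial in $\Gamma_g$ is closed; (P3) every $2$-cell is a $4g$-gon glued along a closed path reading $[a_1,b_1]\cdots[a_g,b_g]$, and every such closed path bounds at most one $2$-cell. (Equivalently, $Y$ is a sub-complex of a covering space of the closed genus $g$ surface with its standard one-vertex CW-structure.) It is compact if and only if it has finitely many cells. Morphisms map $i$-cells to $i$-cells and respect incidence, directions and labels; embeddings are injective morphisms. At each vertex of $Y$ add hanging half-edges so that there are $4g$ half-edges, with clockwise cyclic order $a_1$-outgoing, $b_1$-incoming, $a_1$-incoming, $b_1$-outgoing, $a_2$-outgoing, and so on. The boundary $\partial Y$ is the boundary of a thickening (regular neighborhood) of $Y$. Its components are read as paths of directed edges that have no $4g$-gon on their immediate left (cycles, or bi-infinite lines when $Y$ is not compact);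 from a directed edge such a component continues along the first half-edge, in clockwise order, that belongs to an edge of $Y$. The length $|\partial Y|$ is the number of sides of edges that do not border a $4g$-gon. A \emph{block} is a non-empty path with no half-edges (hanging or not) between successive edges. A \emph{half-block} is a block of length $2g$ and a \emph{long block} is a block of length at least $2g+1$. Two blocks are \emph{consecutive} if the second starts where the first ends, with exactly one half-edge in between. A \emph{long chain} is a path made of consecutive blocks of lengths $2g,2g-1,\dots,2g-1,2g$ (at least two blocks), and a \emph{half-chain} is a cycle made of cyclically consecutive blocks of length $2g-1$. $Y$ is \emph{boundary reduced} if no component of $\partial Y$ contains a long block or a long chain, and \emph{strongly boundary reduced} if no component of $\partial Y$ contains a half-block or a half-chain. If $Y$ is embedded in a (strongly) boundary reduced tiled surface $Z$, then $\mathsf{BR}(Y\hookrightarrow Z)$ (respectively $\mathsf{SBR}(Y\hookrightarrow Z)$) is the intersection of all (strongly) boundary reduced sub-complexes of $Z$ that contain $Y$. \textbf{Proposition.} Let $g\ge2$ and let $Y$ be a compact $g$-tiled surface embedded in a boundary reduced $g$-tiled surface $Z$. Then $\mathsf{BR}(Y\hookrightarrow Z)$ is compact. Moreover, it is obtained from $Y$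 by adding finitely many closed $4g$-gons: there are sub-complexes $Y=Y_0,Y_1,\dots,Y_n=\mathsf{BR}(Y\hookrightarrow Z)$ of $Z$ such that, for each $i<n$, $Y_{i+1}$ is the union of $Y_i$ and all closed $4g$-gons of $Z$ that sit on the left of some directed edge of a certain long block or long chain contained in $\partial Y_i$, and $|\partial Y_{i+1}|\le|\partial Y_i|-2$. The analogous compactness statement fails for the strongly boundary reduced closure: already for $g=2$ there are a strongly boundary reduced tiled surface $Z$ and a compact tiled surface $Y$ embedded in $Z$ such that $\mathsf{SBR}(Y\hookrightarrow Z)$ is not compact. -/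

import Mathlib

universe u v

/-- The generators `a_1, b_1, …, a_g, b_g` of the surface group of genus `g`. -/
inductive SurfaceGen (g : ℕ) : Type
  | a (i : Fin g) : SurfaceGen g
  | b (i : Fin g) : SurfaceGen g

/-- Letters `a_i^{±1}, b_i^{±1}`; the sign `true` means exponent `+1`. -/
abbrev Letter (g : ℕ) : Type := SurfaceGen g × Bool

namespace Letter

variable {g : ℕ}

/-- The inverse letter. -/
def inv (x : Letter g) : Letter g := (x.1, !x.2)

/-- The clockwise cyclic order on the `4g` half-edges at the vertex of the genus `g` surface,
where a half-edge is named by the letter read when one leaves the vertex along it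
(so "`a_i`-outgoing" is `a_i` and "`a_i`-incoming" is `a_i⁻¹`): the half-edge that follows
a given one is determined by
`a_i`-outgoing, `b_i`-incoming, `a_i`-incoming, `b_i`-outgoing, `a_{i+1}`-outgoing, … -/
def clockwise : Letter g → Letter g
  | (.a i, true) => (.b i, false)
  | (.b i, false) => (.a i, false)
  | (.a i, false) => (.b i, true)
  | (.b i, true) => (.a (finRotate g i), true)

end Letter

/-- The word `[a_1, b_1] ⋯ [a_g, b_g]`. -/
def surfaceRelator (g : ℕ) : List (Letter g) :=
  (List.finRange g).flatMap fun i =>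
    [(.a i, true), (.b i, true), (.a i, false), (.b i, false)]

/-- The surface group `⟨a_1, b_1, …, a_g, b_g | [a_1, b_1] ⋯ [a_g, b_g]⟩`. -/
abbrev SurfaceGroup (g : ℕ) : Type :=
  PresentedGroup ({FreeGroup.mk (surfaceRelator g)} : Set (FreeGroup (SurfaceGen g)))

/-- The element of the surface group represented by a word. -/
def wordValue {g : ℕ} (w : List (Letter g)) : SurfaceGroup g :=
  PresentedGroup.mk _ (FreeGroup.mk w)

/-! ### Paths in directed, labeled graphs

`V` and `E` are the vertices and edges, `src`, `tgt`, `label` the initial vertex, terminal vertex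
and label of an edge. A dart `(e, true)` is the edge `e` traversed in its own direction, and
`(e, false)` is `e` traversed against its direction. -/

namespace LabeledGraph

variable {V : Type u} {E : Type u} {g : ℕ}

def dartSrc (src tgt : E → V) (d : E × Bool) : V := if d.2 then src d.1 else tgt d.1

def dartTgt (src tgt : E → V) (d : E × Bool) : V := if d.2 then tgt d.1 else src d.1

def dartLetter (label : E → SurfaceGen g) (d : E × Bool) : Letter g := (label d.1, d.2)

/-- A sequence of darts, each starting where the previous one ends. -/
def IsPath (src tgt : E → V) (p : List (E × Bool)) : Prop :=
  p.IsChain fun d d' => dartTgt src tgt d = dartSrc src tgt d'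

/-- The path starts and ends at the same vertex. -/
def IsClosed (src tgt : E → V) (p : List (E × Bool)) : Prop :=
  p.head?.map (dartSrc src tgt) = p.getLast?.map (dartTgt src tgt)

end LabeledGraph

/-- A `g`-tiled surface: an at most two-dimensional CW-complex with vertices `V`, edges `E` and
2-cells `F`, whose edges are directed and labeled by the generators, subject to the properties
P1, P2, P3. The attaching path `bdry f` of a 2-cell `f` is written from its unique starting point
at which it reads the word `[a_1, b_1] ⋯ [a_g, b_g]`. -/
structure TiledSurface (g : ℕ) : Type (u + 1) where
  V : Type u
  E : Type u
  F : Type u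
  src : E → V
  tgt : E → V
  label : E → SurfaceGen g
  bdry : F → List (E × Bool)
  /-- P1: at most one outgoing edge with a given label at each vertex. -/
  out_unique : ∀ e e' : E, src e = src e' → label e = label e' → e = e'
  /-- P1: at most one incoming edge with a given label at each vertex. -/
  in_unique : ∀ e e' : E, tgt e = tgt e' → label e = label e' → e = e'
  /-- P2: a path that reads a word representing the identity of the surface group is closed. -/
  closed_of_trivial : ∀ p : List (E × Bool), LabeledGraph.IsPath src tgt p →
    wordValue (p.map (LabeledGraph.dartLetter label)) = 1 → LabeledGraph.IsClosed src tgt p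
  /-- P3: every 2-cell is a `4g`-gon glued along a closed path reading the relator. -/
  bdry_isPath : ∀ f, LabeledGraph.IsPath src tgt (bdry f)
  bdry_isClosed : ∀ f, LabeledGraph.IsClosed src tgt (bdry f)
  bdry_word : ∀ f, (bdry f).map (LabeledGraph.dartLetter label) = surfaceRelator g
  /-- P3: every such closed path bounds at most one 2-cell. -/
  bdry_injective : Function.Injective bdry

namespace TiledSurface

variable {g : ℕ}

section Basic

variable (Y : TiledSurface.{u} g)

/-- Directed edges. -/
abbrev Dart : Type u := Y.E × Bool

def dsrc (d : Y.Dart) : Y.V := LabeledGraph.dartSrc Y.src Y.tgt d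

def dtgt (d : Y.Dart) : Y.V := LabeledGraph.dartTgt Y.src Y.tgt d

def letter (d : Y.Dart) : Letter g := LabeledGraph.dartLetter Y.label d

/-- A CW-complex is compact iff it has finitely many cells. -/
def IsCompact : Prop := Finite Y.V ∧ Finite Y.E ∧ Finite Y.F

/-- The dart `d'` starts where `d` ends, and in the clockwise order at this vertex there are
exactly `m` half-edges (hanging or not) between `d` and `d'`, `0 ≤ m ≤ 4g - 1`. -/
def Between (d d' : Y.Dart) (m : ℕ) : Prop :=
  Y.dtgt d = Y.dsrc d' ∧ m < 4 * g ∧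
    Letter.clockwise^[m + 1] (Letter.inv (Y.letter d)) = Y.letter d'

/-- The half-edge named `x` at the vertex `v` is hanging: it is not part of an edge of `Y`. -/
def IsHanging (v : Y.V) (x : Letter g) : Prop :=
  ¬ ∃ d : Y.Dart, Y.dsrc d = v ∧ Y.letter d = x

/-- The `4g`-gon `f` is on the left of the dart `d`: the attaching paths of 2-cells are
oriented so that the 2-cell is on the left. -/
def LeftOf (f : Y.F) (d : Y.Dart) : Prop := d ∈ Y.bdry f

/-- The dart `d` runs along the boundary of the thick version of `Y`: there is no `4g`-gon on
its immediate left. -/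
def IsBoundaryDart (d : Y.Dart) : Prop := ∀ f, ¬ Y.LeftOf f d

/-- The length of the boundary: the number of sides of edges without a `4g`-gon. -/
noncomputable def boundaryLength : ℕ := Set.ncard {d : Y.Dart | Y.IsBoundaryDart d}

/-- The boundary component of the thick version that runs along `d` continues along `d'`:
all half-edges between `d` and `d'` are hanging. -/
def BoundaryNext (d d' : Y.Dart) : Prop :=
  ∃ m, Y.Between d d' m ∧
    ∀ k, 1 ≤ k → k ≤ m → Y.IsHanging (Y.dtgt d) (Letter.clockwise^[k] (Letter.inv (Y.letter d)))

/-- A path contained in a boundary component of (the thick version of) `Y`. -/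
def IsBoundaryPath (p : List Y.Dart) : Prop :=
  (∀ d ∈ p, Y.IsBoundaryDart d) ∧ p.IsChain Y.BoundaryNext

/-- A boundary component of (the thick version of) `Y` that is a cycle. -/
def IsBoundaryCycle (p : List Y.Dart) : Prop :=
  p ≠ [] ∧ Y.IsBoundaryPath p ∧ ∀ d ∈ p.getLast?, ∀ d' ∈ p.head?, Y.BoundaryNext d d'

/-- A block: a non-empty path with no half-edges between successive edges. -/
def IsBlock (p : List Y.Dart) : Prop := p ≠ [] ∧ p.IsChain fun d d' => Y.Between d d' 0

def IsHalfBlock (p : List Y.Dart) : Prop := Y.IsBlock p ∧ p.length = 2 * g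

def IsLongBlock (p : List Y.Dart) : Prop := Y.IsBlock p ∧ 2 * g + 1 ≤ p.length

/-- Two blocks are consecutive if there is exactly one half-edge between the last edge of the
first one and the first edge of the second one. -/
def Consecutive (p q : List Y.Dart) : Prop :=
  ∀ d ∈ p.getLast?, ∀ d' ∈ q.head?, Y.Between d d' 1

/-- A chain: a sequence of consecutive blocks. -/
def IsBlockChain (B : List (List Y.Dart)) : Prop :=
  (∀ p ∈ B, Y.IsBlock p) ∧ B.IsChain Y.Consecutive

/-- A long chain: consecutive blocks of lengths `2g, 2g-1, …, 2g-1, 2g`. -/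
def IsLongChain (p : List Y.Dart) : Prop :=
  ∃ (B : List (List Y.Dart)) (k : ℕ), p = B.flatten ∧ Y.IsBlockChain B ∧
    B.map List.length = 2 * g :: (List.replicate k (2 * g - 1) ++ [2 * g])

/-- A half-chain: a cyclic chain of consecutive blocks of length `2g-1` each. -/
def IsHalfChain (p : List Y.Dart) : Prop :=
  ∃ B : List (List Y.Dart), B ≠ [] ∧ p = B.flatten ∧ Y.IsBlockChain B ∧
    (∀ q ∈ B, q.length = 2 * g - 1) ∧
    ∀ q ∈ B.getLast?, ∀ q' ∈ B.head?, Y.Consecutive q q'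

/-- No boundary component contains a long block or a long chain. -/
def BoundaryReduced : Prop :=
  ∀ p : List Y.Dart, Y.IsBoundaryPath p → ¬ Y.IsLongBlock p ∧ ¬ Y.IsLongChain p

/-- No boundary component contains a half-block or a half-chain. -/
def StronglyBoundaryReduced : Prop :=
  (∀ p : List Y.Dart, Y.IsBoundaryPath p → ¬ Y.IsHalfBlock p) ∧
    ∀ p : List Y.Dart, Y.IsBoundaryCycle p → ¬ Y.IsHalfChain p

end Basic

/-- Morphisms of tiled surfaces: they map `i`-cells to `i`-cells and respect incidences,
directions and labels. -/
structure Hom (Y : TiledSurface.{u} g) (Z : TiledSurface.{v} g) where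
  onV : Y.V → Z.V
  onE : Y.E → Z.E
  onF : Y.F → Z.F
  src_onE : ∀ e, Z.src (onE e) = onV (Y.src e)
  tgt_onE : ∀ e, Z.tgt (onE e) = onV (Y.tgt e)
  label_onE : ∀ e, Z.label (onE e) = Y.label e
  bdry_onF : ∀ f, Z.bdry (onF f) = (Y.bdry f).map (Prod.map onE id)

/-- An embedding is a morphism that is injective on cells. -/
def Hom.IsEmbedding {Y : TiledSurface.{u} g} {Z : TiledSurface.{v} g} (φ : Hom Y Z) : Prop :=
  Function.Injective φ.onV ∧ Function.Injective φ.onE ∧ Function.Injective φ.onF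

/-- Sub-complexes of a tiled surface: sets of cells that contain, with each cell, the cells of
smaller dimension at its boundary. -/
@[ext]
structure Subcomplex (Z : TiledSurface.{u} g) where
  verts : Set Z.V
  edges : Set Z.E
  faces : Set Z.F
  src_mem : ∀ e ∈ edges, Z.src e ∈ verts
  tgt_mem : ∀ e ∈ edges, Z.tgt e ∈ verts
  bdry_mem : ∀ f ∈ faces, ∀ d ∈ Z.bdry f, d.1 ∈ edges

namespace Subcomplex

variable {Z : TiledSurface.{u} g}

instance : LE (Subcomplex Z) where
  le X X' := X.verts ⊆ X'.verts ∧ X.edges ⊆ X'.edges ∧ X.faces ⊆ X'.faces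

/-- The intersection of a family of sub-complexes. -/
def inter (S : Set (Subcomplex Z)) : Subcomplex Z where
  verts := {v | ∀ X ∈ S, v ∈ X.verts}
  edges := {e | ∀ X ∈ S, e ∈ X.edges}
  faces := {f | ∀ X ∈ S, f ∈ X.faces}
  src_mem e he X hX := X.src_mem e (he X hX)
  tgt_mem e he X hX := X.tgt_mem e (he X hX)
  bdry_mem f hf d hd X hX := X.bdry_mem f (hf X hX) d hd

/-- The union of a sub-complex with a set of closed `4g`-gons. -/
def adjoin (X : Subcomplex Z) (S : Set Z.F) : Subcomplex Z where
  verts := X.verts ∪ {v | ∃ f ∈ S, ∃ d ∈ Z.bdry f, v = Z.src d.1 ∨ v = Z.tgt d.1}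
  edges := X.edges ∪ {e | ∃ f ∈ S, ∃ d ∈ Z.bdry f, e = d.1}
  faces := X.faces ∪ S
  src_mem := by
    rintro e (he | ⟨f, hf, d, hd, rfl⟩)
    · exact Or.inl (X.src_mem e he)
    · exact Or.inr ⟨f, hf, d, hd, Or.inl rfl⟩
  tgt_mem := by
    rintro e (he | ⟨f, hf, d, hd, rfl⟩)
    · exact Or.inl (X.tgt_mem e he)
    · exact Or.inr ⟨f, hf, d, hd, Or.inr rfl⟩
  bdry_mem := by
    rintro f (hf | hf) d hd
    · exact Or.inl (X.bdry_mem f hf d hd)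
    · exact Or.inr ⟨f, hf, d, hd, rfl⟩

/-- A dart of a sub-complex, as a dart of the ambient tiled surface. -/
def toAmbient (X : Subcomplex Z) (d : X.edges × Bool) : Z.E × Bool := (d.1.1, d.2)

/-- The attaching path of a 2-cell of a sub-complex. -/
def subBdry (X : Subcomplex Z) (f : X.faces) : List (X.edges × Bool) :=
  (Z.bdry f.1).attach.map fun d => (⟨d.1.1, X.bdry_mem f.1 f.2 d.1 d.2⟩, d.1.2)

theorem map_subBdry (X : Subcomplex Z) (f : X.faces) :
    (X.subBdry f).map X.toAmbient = Z.bdry f.1 := by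
  rw [subBdry, List.map_map]
  exact List.attach_map_subtype_val _

/-- Initial vertex of an edge of a sub-complex. -/
def subSrc (X : Subcomplex Z) (e : X.edges) : X.verts := ⟨Z.src e.1, X.src_mem e.1 e.2⟩

/-- Terminal vertex of an edge of a sub-complex. -/
def subTgt (X : Subcomplex Z) (e : X.edges) : X.verts := ⟨Z.tgt e.1, X.tgt_mem e.1 e.2⟩

theorem coe_dartSrc (X : Subcomplex Z) (d : X.edges × Bool) :
    (LabeledGraph.dartSrc X.subSrc X.subTgt d).1
      = LabeledGraph.dartSrc Z.src Z.tgt (X.toAmbient d) := by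
  rcases d with ⟨e, _ | _⟩ <;> rfl

theorem coe_dartTgt (X : Subcomplex Z) (d : X.edges × Bool) :
    (LabeledGraph.dartTgt X.subSrc X.subTgt d).1
      = LabeledGraph.dartTgt Z.src Z.tgt (X.toAmbient d) := by
  rcases d with ⟨e, _ | _⟩ <;> rfl

theorem isPath_iff (X : Subcomplex Z) (p : List (X.edges × Bool)) :
    LabeledGraph.IsPath X.subSrc X.subTgt p ↔
      LabeledGraph.IsPath Z.src Z.tgt (p.map X.toAmbient) := by
  simp only [LabeledGraph.IsPath, List.isChain_map, ← coe_dartSrc, ← coe_dartTgt,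
    Subtype.coe_inj]

theorem isClosed_iff (X : Subcomplex Z) (p : List (X.edges × Bool)) :
    LabeledGraph.IsClosed X.subSrc X.subTgt p ↔
      LabeledGraph.IsClosed Z.src Z.tgt (p.map X.toAmbient) := by
  unfold LabeledGraph.IsClosed
  rw [List.head?_map, List.getLast?_map]
  cases p.head? <;> cases p.getLast? <;>
    simp [← coe_dartSrc, ← coe_dartTgt, Subtype.coe_inj]

/-- A sub-complex of a tiled surface, as a tiled surface for its own sake. -/
def toTiledSurface (X : Subcomplex Z) : TiledSurface.{u} g where
  V := X.verts
  E := X.edges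
  F := X.faces
  src := X.subSrc
  tgt := X.subTgt
  label e := Z.label e.1
  bdry := X.subBdry
  out_unique e e' h h' := Subtype.ext (Z.out_unique _ _ (congrArg Subtype.val h) h')
  in_unique e e' h h' := Subtype.ext (Z.in_unique _ _ (congrArg Subtype.val h) h')
  closed_of_trivial p hp hw := by
    rw [isClosed_iff]
    refine Z.closed_of_trivial _ ((isPath_iff X p).1 hp) ?_
    rw [List.map_map]
    exact hw
  bdry_isPath f := by
    rw [isPath_iff, map_subBdry]
    exact Z.bdry_isPath f.1
  bdry_isClosed f := by
    rw [isClosed_iff, map_subBdry]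
    exact Z.bdry_isClosed f.1
  bdry_word f := by
    rw [← Z.bdry_word f.1, ← map_subBdry, List.map_map]
    rfl
  bdry_injective f f' h := by
    apply Subtype.ext
    apply Z.bdry_injective
    rw [← map_subBdry, ← map_subBdry, h]

/-- The `4g`-gons of the ambient tiled surface that sit along a path of a sub-complex
(on its left). -/
def facesAlong (X : Subcomplex Z) (p : List X.toTiledSurface.Dart) : Set Z.F :=
  {f | ∃ d ∈ p, Z.LeftOf f (X.toAmbient d)}

/-- `X'` arises from `X` by adding all closed `4g`-gons of the ambient tiled surface that sit
along some long block or some long chain contained in the boundary of `X`. -/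
def Step (X X' : Subcomplex Z) : Prop :=
  ∃ p : List X.toTiledSurface.Dart, X.toTiledSurface.IsBoundaryPath p ∧
    (X.toTiledSurface.IsLongBlock p ∨ X.toTiledSurface.IsLongChain p) ∧
    X' = X.adjoin (X.facesAlong p)

end Subcomplex

namespace Hom

variable {Y : TiledSurface.{u} g} {Z : TiledSurface.{v} g}

/-- The image of a morphism. -/
def range (φ : Hom Y Z) : Subcomplex Z where
  verts := Set.range φ.onV
  edges := Set.range φ.onE
  faces := Set.range φ.onF
  src_mem := by
    rintro _ ⟨e, rfl⟩
    exact ⟨_, (φ.src_onE e).symm⟩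
  tgt_mem := by
    rintro _ ⟨e, rfl⟩
    exact ⟨_, (φ.tgt_onE e).symm⟩
  bdry_mem := by
    rintro _ ⟨f, rfl⟩ d hd
    rw [φ.bdry_onF, List.mem_map] at hd
    obtain ⟨d', -, rfl⟩ := hd
    exact ⟨d'.1, rfl⟩

/-- The boundary reduced closure: the intersection of all boundary reduced tiled surfaces that
lie between the image of `Y` and `Z`. -/
def brClosure (φ : Hom Y Z) : Subcomplex Z :=
  Subcomplex.inter {X | φ.range ≤ X ∧ X.toTiledSurface.BoundaryReduced}

/-- The strongly boundary reduced closure: the intersection of all strongly boundary reduced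
tiled surfaces that lie between the image of `Y` and `Z`. -/
def sbrClosure (φ : Hom Y Z) : Subcomplex Z :=
  Subcomplex.inter {X | φ.range ≤ X ∧ X.toTiledSurface.StronglyBoundaryReduced}

end Hom

end TiledSurface

/-! A `4g`-gon on the left of one dart of a block is on the left of the whole block, because P1
makes the sides of the polygon and the darts of the block agree one after another. So a block either
runs along a single polygon or consists of boundary darts only (`IsBlock.exists_leftOf_or`).

Let `W` be boundary reduced and contain the given complex. A long block must run along a polygon of
`W`. For a long chain, suppose its first block lies on the boundary of `W`. If the half-edge after
it belonged to an edge of `W`, that edge would lengthen the block to a long block; at a later gap,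
it would cut off a shorter long chain. So all gaps are hanging and the whole chain lies on the
boundary, a contradiction (`BoundaryReduced.not_isBlockChain_append`). If instead some block runs
along a polygon and the next one lies on the boundary, the edge in the gap, traversed backwards,
extends that next block and starts a long block or a long chain, to which the same argument applies.
Hence all polygons along a long block or long chain lie in every such `W`, and each step stays
inside the closure.

For the length, sort the `4g` sides of an added polygon into old ones (edges already present), inner
ones (new, with another added side opposite) and outer ones. Old sides disappear from the boundary
and only outer sides can create new boundary. One polygon along a long block has at least `2g+1` old
sides. In a long chain a middle polygon has at least `2g-1` old and two inner sides, and an end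
polygon at least `2g` old and one inner side. Summing over distinct polygons gives a surplus of at
least two old sides over outer ones. The process therefore stops, necessarily at a boundary reduced
complex, which is then the closure.

For the counterexample, take an infinite cyclic cover of the genus two surface in which the octagons
`n` and `n+1` share a half-block. Strong reducedness then forces each octagon to bring in the next.
-/

namespace Letter

/-! ### Cyclic order of letters and positions in the relator -/

variable {g : ℕ}

/-- The letter that follows `x` in the cyclic word `[a_1, b_1] ⋯ [a_g, b_g]`. -/
def next (x : Letter g) : Letter g := clockwise (inv x)

/-- The position of a letter in the word `[a_1, b_1] ⋯ [a_g, b_g]`. -/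
def rank : Letter g → ℕ
  | (.a i, true) => 4 * i
  | (.b i, true) => 4 * i + 1
  | (.a i, false) => 4 * i + 2
  | (.b i, false) => 4 * i + 3

theorem rank_lt (x : Letter g) : x.rank < 4 * g := by
  rcases x with ⟨i | i, _ | _⟩ <;> simp only [rank] <;> omega

theorem genus_pos (x : Letter g) : 0 < g := by
  have := x.rank_lt
  omega

theorem rank_injective : Function.Injective (rank (g := g)) := by
  rintro ⟨i | i, _ | _⟩ ⟨j | j, _ | _⟩ h <;> simp only [rank] at h <;>
    first
      | omega
      | (have : i = j := Fin.ext (by omega)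
         rw [this])

theorem inv_inv (x : Letter g) : inv (inv x) = x := by
  rcases x with ⟨i | i, _ | _⟩ <;> rfl

theorem clockwise_ne (x : Letter g) : clockwise x ≠ x := by
  rcases x with ⟨i | i, _ | _⟩ <;> simp [clockwise]

theorem clockwise_injective : Function.Injective (clockwise (g := g)) := by
  rintro ⟨i | i, _ | _⟩ ⟨j | j, _ | _⟩ h <;> simp_all [clockwise]

theorem next_injective : Function.Injective (next (g := g)) := fun x y h => by
  have := clockwise_injective h
  rw [← inv_inv x, this, inv_inv]

theorem rank_next (x : Letter g) : (next x).rank = (x.rank + 1) % (4 * g) := by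
  have hx := x.rank_lt
  rcases x with ⟨i | i, _ | _⟩
  · simp only [next, inv, clockwise, rank, Bool.not_false] at *
    rw [Nat.mod_eq_of_lt (by omega)]
  · simp only [next, inv, clockwise, rank, Bool.not_true] at *
    rw [Nat.mod_eq_of_lt (by omega)]
  · simp only [next, inv, clockwise, rank, Bool.not_false] at *
    obtain ⟨n, rfl⟩ : ∃ n, g = n + 1 := ⟨g - 1, by omega⟩
    rw [finRotate_apply, Fin.val_add_one]
    split_ifs with h
    · subst h
      simp only [Fin.val_last]
      rw [show 4 * n + 3 + 1 = 4 * (n + 1) by ring, Nat.mod_self]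
    · have : (i : ℕ) ≠ n := fun h' => h (Fin.ext h')
      rw [Nat.mod_eq_of_lt (by omega)]
      ring
  · simp only [next, inv, clockwise, rank, Bool.not_true] at *
    rw [Nat.mod_eq_of_lt (by omega)]

instance : Finite (Letter g) := Finite.of_injective (fun x : Letter g => (⟨x.rank, x.rank_lt⟩ :
  Fin (4 * g))) fun x y h => rank_injective (by simpa using h)

theorem next_surjective : Function.Surjective (next (g := g)) :=
  Finite.surjective_of_injective next_injective

end Letter

theorem surfaceRelator_map_rank (g : ℕ) :
    (surfaceRelator g).map Letter.rank = List.range (4 * g) := by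
  have key : ∀ n, (List.range n).flatMap (fun i => [4 * i, 4 * i + 1, 4 * i + 2, 4 * i + 3])
      = List.range (4 * n) := by
    intro n
    induction n with
    | zero => rfl
    | succ n ih =>
      rw [List.range_succ, List.flatMap_append, ih, show 4 * (n + 1) = 4 * n + 1 + 1 + 1 + 1 by ring]
      simp [List.range_succ]
  rw [← key, surfaceRelator, List.map_flatMap, ← List.map_coe_finRange_eq_range, List.flatMap_map]
  rfl

theorem surfaceRelator_length (g : ℕ) : (surfaceRelator g).length = 4 * g := by
  rw [← List.length_map (f := Letter.rank), surfaceRelator_map_rank, List.length_range]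

namespace TiledSurface

variable {g : ℕ}

/-! ### Darts, blocks and the sides of a `4g`-gon -/

section Darts

variable (Z : TiledSurface.{u} g)

/-- The dart that traverses the same edge backwards. -/
def rev (d : Z.Dart) : Z.Dart := (d.1, !d.2)

/-- The dart `d'` follows `d` in a block. -/
def Follows (d d' : Z.Dart) : Prop :=
  Z.dtgt d = Z.dsrc d' ∧ (Z.letter d).next = Z.letter d'

variable {Z}

theorem rev_rev (d : Z.Dart) : Z.rev (Z.rev d) = d := by
  simp [rev]

theorem dsrc_rev (d : Z.Dart) : Z.dsrc (Z.rev d) = Z.dtgt d := by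
  rcases d with ⟨e, _ | _⟩ <;> rfl

theorem dtgt_rev (d : Z.Dart) : Z.dtgt (Z.rev d) = Z.dsrc d := by
  rcases d with ⟨e, _ | _⟩ <;> rfl

theorem letter_rev (d : Z.Dart) : Z.letter (Z.rev d) = (Z.letter d).inv := rfl

/-- This is P1 for darts: the sign in the letter decides whether outgoing or incoming uniqueness
applies. -/
theorem dart_eq_of_dsrc {d d' : Z.Dart} (h : Z.dsrc d = Z.dsrc d')
    (hl : Z.letter d = Z.letter d') : d = d' := by
  rcases d with ⟨e, s⟩
  rcases d' with ⟨e', s'⟩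
  obtain ⟨h1, h2⟩ := Prod.ext_iff.1 hl
  simp only [letter, LabeledGraph.dartLetter] at h1 h2
  subst h2
  cases s
  · rw [Z.in_unique e e' h h1]
  · rw [Z.out_unique e e' h h1]

theorem dart_eq_of_dtgt {d d' : Z.Dart} (h : Z.dtgt d = Z.dtgt d')
    (hl : Z.letter d = Z.letter d') : d = d' := by
  have : Z.rev d = Z.rev d' := dart_eq_of_dsrc (by rw [dsrc_rev, dsrc_rev, h])
    (by rw [letter_rev, letter_rev, hl])
  rw [← rev_rev d, this, rev_rev]

theorem between_zero_iff {d d' : Z.Dart} : Z.Between d d' 0 ↔ Z.Follows d d' := by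
  have := (Z.letter d).genus_pos
  simp only [Between, Follows, Letter.next, zero_add, Function.iterate_one]
  constructor
  · exact fun h => ⟨h.1, h.2.2⟩
  · exact fun h => ⟨h.1, by omega, h.2⟩

theorem isBlock_iff {p : List Z.Dart} : Z.IsBlock p ↔ p ≠ [] ∧ p.IsChain Z.Follows := by
  simp only [IsBlock, between_zero_iff]

theorem Follows.right_unique {d d₁ d₂ : Z.Dart} (h₁ : Z.Follows d d₁) (h₂ : Z.Follows d d₂) :
    d₁ = d₂ :=
  dart_eq_of_dsrc (h₁.1.symm.trans h₂.1) (h₁.2.symm.trans h₂.2)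

theorem Follows.left_unique {d d₁ d₂ : Z.Dart} (h₁ : Z.Follows d₁ d) (h₂ : Z.Follows d₂ d) :
    d₁ = d₂ :=
  dart_eq_of_dtgt (h₁.1.trans h₂.1.symm) (Letter.next_injective (h₁.2.trans h₂.2.symm))

/-- A chain of at most `4g` darts, each following the previous one, has no repetitions. -/
theorem nodup_of_isChain_follows {p : List Z.Dart} (hp : p.IsChain Z.Follows)
    (hl : p.length ≤ 4 * g) : p.Nodup := by
  have hrank : ∀ (i : ℕ) (hi : i < p.length),
      (Z.letter p[i]).rank = ((Z.letter p[0]).rank + i) % (4 * g) := by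
    intro i
    induction i with
    | zero => intro hi; rw [Nat.add_zero, Nat.mod_eq_of_lt (Letter.rank_lt _)]
    | succ i ih =>
      intro hi
      have := (List.isChain_iff_getElem.1 hp i hi).2
      rw [← this, Letter.rank_next, ih (by omega), Nat.mod_add_mod, add_assoc]
  rw [List.nodup_iff_injective_getElem]
  rintro ⟨i, hi⟩ ⟨j, hj⟩ h
  have h' : ((Z.letter p[0]).rank + i) % (4 * g) = ((Z.letter p[0]).rank + j) % (4 * g) := by
    rw [← hrank i hi, ← hrank j hj]
    exact congrArg (fun d => (Z.letter d).rank) h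
  have : i ≡ j [MOD 4 * g] := Nat.ModEq.add_left_cancel' _ h'
  exact Fin.ext (this.eq_of_lt_of_lt (by omega) (by omega))

theorem bdry_length (f : Z.F) : (Z.bdry f).length = 4 * g := by
  rw [← surfaceRelator_length, ← Z.bdry_word f, List.length_map]

theorem rank_bdry_getElem (f : Z.F) (i : ℕ) (hi : i < (Z.bdry f).length) :
    (Z.letter (Z.bdry f)[i]).rank = i := by
  have h : ((Z.bdry f).map fun d => (Z.letter d).rank) = List.range (4 * g) := by
    rw [← surfaceRelator_map_rank, ← Z.bdry_word f, List.map_map]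
    rfl
  have h2 : ((Z.bdry f).map fun d => (Z.letter d).rank)[i]? = some i := by
    rw [h, List.getElem?_range (by rwa [← bdry_length f])]
  simpa [List.getElem?_eq_getElem hi] using h2

theorem bdry_nodup (f : Z.F) : (Z.bdry f).Nodup := by
  rw [List.nodup_iff_injective_getElem]
  rintro ⟨i, hi⟩ ⟨j, hj⟩ h
  apply Fin.ext
  have := congrArg (fun d => (Z.letter d).rank) h
  simpa only [rank_bdry_getElem] using this

theorem LeftOf.dart_unique {f : Z.F} {d d' : Z.Dart} (h : Z.LeftOf f d) (h' : Z.LeftOf f d')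
    (hl : Z.letter d = Z.letter d') : d = d' := by
  obtain ⟨i, hi, rfl⟩ := List.getElem_of_mem h
  obtain ⟨j, hj, rfl⟩ := List.getElem_of_mem h'
  have := congrArg Letter.rank hl
  rw [rank_bdry_getElem, rank_bdry_getElem] at this
  subst this
  rfl

theorem exists_leftOf_letter (f : Z.F) (x : Letter g) : ∃ d, Z.LeftOf f d ∧ Z.letter d = x := by
  have hi : x.rank < (Z.bdry f).length := by rw [bdry_length]; exact x.rank_lt
  exact ⟨(Z.bdry f)[x.rank], List.getElem_mem hi,
    Letter.rank_injective (rank_bdry_getElem f _ hi)⟩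

theorem LeftOf.exists_follows {f : Z.F} {d : Z.Dart} (h : Z.LeftOf f d) :
    ∃ d', Z.LeftOf f d' ∧ Z.Follows d d' := by
  obtain ⟨i, hi, rfl⟩ := List.getElem_of_mem h
  have hlen := bdry_length f
  by_cases hi' : i + 1 < (Z.bdry f).length
  · refine ⟨(Z.bdry f)[i + 1], List.getElem_mem hi', ?_, Letter.rank_injective ?_⟩
    · exact List.isChain_iff_getElem.1 (Z.bdry_isPath f) i hi'
    · rw [Letter.rank_next, rank_bdry_getElem, rank_bdry_getElem, Nat.mod_eq_of_lt (by omega)]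
  -- The last side is followed by the first one, since the attaching path is closed and positions
  -- are taken modulo `4g`.
  · have h0 : 0 < (Z.bdry f).length := by omega
    have hil : i = (Z.bdry f).length - 1 := by omega
    refine ⟨(Z.bdry f)[0], List.getElem_mem h0, ?_, Letter.rank_injective ?_⟩
    · have hc := Z.bdry_isClosed f
      rw [LabeledGraph.IsClosed, List.head?_eq_getElem?, List.getLast?_eq_getElem?,
        List.getElem?_eq_getElem h0, List.getElem?_eq_getElem (by omega)] at hc
      simp only [Option.map_some, Option.some.injEq] at hc
      subst hil
      exact hc.symm
    · rw [Letter.rank_next, rank_bdry_getElem, rank_bdry_getElem,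
        show i + 1 = 4 * g by omega, Nat.mod_self]

/-- The next side of the polygon leaves the same vertex with the same letter as `d'`, so P1
identifies them. -/
theorem LeftOf.of_follows {f : Z.F} {d d' : Z.Dart} (h : Z.LeftOf f d) (hd : Z.Follows d d') :
    Z.LeftOf f d' := by
  obtain ⟨d₁, h₁, h₂⟩ := h.exists_follows
  rwa [hd.right_unique h₂]

theorem LeftOf.exists_follows_left {f : Z.F} {d : Z.Dart} (h : Z.LeftOf f d) :
    ∃ d', Z.LeftOf f d' ∧ Z.Follows d' d := by
  obtain ⟨x, hx⟩ := Letter.next_surjective (Z.letter d)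
  obtain ⟨d₁, h₁, rfl⟩ := exists_leftOf_letter f x
  obtain ⟨d₂, h₂, h₃⟩ := h₁.exists_follows
  rw [h.dart_unique h₂ (by rw [← h₃.2, hx])]
  exact ⟨d₁, h₁, h₃⟩

theorem LeftOf.of_follows_left {f : Z.F} {d d' : Z.Dart} (h : Z.LeftOf f d')
    (hd : Z.Follows d d') : Z.LeftOf f d := by
  obtain ⟨d₁, h₁, h₂⟩ := h.exists_follows_left
  rwa [hd.left_unique h₂]

/-- Walking on from `d` traces the sides of both polygons simultaneously, so their attaching paths
agree and P3 applies. -/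
theorem LeftOf.face_unique {f f' : Z.F} {d : Z.Dart} (h : Z.LeftOf f d) (h' : Z.LeftOf f' d) :
    f = f' := by
  have key : ∀ n : ℕ, ∃ d₁, Z.LeftOf f d₁ ∧ Z.LeftOf f' d₁ ∧
      (Z.letter d₁).rank = ((Z.letter d).rank + n) % (4 * g) := by
    intro n
    induction n with
    | zero => exact ⟨d, h, h', by rw [Nat.add_zero, Nat.mod_eq_of_lt (Letter.rank_lt _)]⟩
    | succ n ih =>
      obtain ⟨d₁, h₁, h₂, h₃⟩ := ih
      obtain ⟨d₂, h₄, h₅⟩ := h₁.exists_follows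
      exact ⟨d₂, h₄, h₂.of_follows h₅, by
        rw [← h₅.2, Letter.rank_next, h₃, Nat.mod_add_mod, add_assoc]⟩
  apply Z.bdry_injective
  apply List.ext_getElem (by rw [bdry_length, bdry_length])
  intro i hi hi'
  have hlen := bdry_length f
  have hd := (Z.letter d).rank_lt
  -- This number of steps leads from the position of `d` past the end of the relator to position
  -- `i`.
  obtain ⟨d₁, h₁, h₂, h₃⟩ := key (4 * g - (Z.letter d).rank + i)
  rw [show (Z.letter d).rank + (4 * g - (Z.letter d).rank + i) = i + 4 * g by omega,
    Nat.add_mod_right, Nat.mod_eq_of_lt (by omega)] at h₃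
  rw [← h₁.dart_unique (List.getElem_mem hi) (Letter.rank_injective (by
      rw [rank_bdry_getElem, h₃])),
    ← h₂.dart_unique (List.getElem_mem hi') (Letter.rank_injective (by
      rw [rank_bdry_getElem, h₃]))]

/-- A `4g`-gon on the left of one dart of a block is on the left of all of them. -/
theorem LeftOf.of_isChain {f : Z.F} {p : List Z.Dart} (hp : p.IsChain Z.Follows) {d : Z.Dart}
    (hd : d ∈ p) (h : Z.LeftOf f d) : ∀ d' ∈ p, Z.LeftOf f d' := by
  induction p generalizing d with
  | nil => simp
  | cons e p ih =>
    cases p with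
    | nil => simp_all
    | cons e' p =>
      obtain ⟨hee, hp'⟩ := List.isChain_cons_cons.1 hp
      rcases List.mem_cons.1 hd with rfl | hd
      · exact List.forall_mem_cons.2 ⟨h, ih hp' List.mem_cons_self (h.of_follows hee)⟩
      · have hp := ih hp' hd h
        exact List.forall_mem_cons.2 ⟨(hp e' List.mem_cons_self).of_follows_left hee, hp⟩

end Darts
end TiledSurface

namespace TiledSurface

variable {g : ℕ}

/-! ### Long blocks and long chains in a boundary reduced surface -/

section LongBlocks

variable {Z : TiledSurface.{u} g}

theorem Follows.boundaryNext {d d' : Z.Dart} (h : Z.Follows d d') : Z.BoundaryNext d d' :=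
  ⟨0, between_zero_iff.2 h, fun k h1 h0 => by omega⟩

/-- If there is one half-edge between `d` and `d'`, and it is part of the edge of `h`, then
`d'` follows the reverse of `h`. -/
theorem Between.rev_follows {d d' h : Z.Dart} (hb : Z.Between d d' 1) (hf : Z.Follows d h) :
    Z.Follows (Z.rev h) d' := by
  refine ⟨?_, ?_⟩
  · rw [dtgt_rev, ← hf.1, hb.1]
  · rw [letter_rev, Letter.next, Letter.inv_inv, ← hf.2, ← hb.2.2]
    rfl

theorem Between.follows_rev {d d' h : Z.Dart} (hb : Z.Between d d' 1) (hf : Z.Follows h d') :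
    Z.Follows d (Z.rev h) := by
  refine ⟨?_, ?_⟩
  · rw [dsrc_rev, hf.1, hb.1]
  · rw [letter_rev]
    apply Letter.clockwise_injective
    exact hb.2.2.trans hf.2.symm

theorem isHanging_iff {d : Z.Dart} :
    Z.IsHanging (Z.dtgt d) (Z.letter d).next ↔ ¬ ∃ h, Z.Follows d h := by
  simp only [IsHanging, Follows, eq_comm]

theorem Between.boundaryNext {d d' : Z.Dart} (hb : Z.Between d d' 1)
    (hf : ¬ ∃ h, Z.Follows d h) : Z.BoundaryNext d d' :=
  ⟨1, hb, fun k h1 h2 => by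
    obtain rfl : k = 1 := by omega
    exact isHanging_iff.2 hf⟩

/-- If a boundary component runs along `d` and `d'` and there is one half-edge between them, then
this half-edge is hanging. -/
theorem BoundaryNext.not_exists_follows {d d' : Z.Dart} (h : Z.BoundaryNext d d')
    (hb : Z.Between d d' 1) : ¬ ∃ h, Z.Follows d h := by
  obtain ⟨m, hm, hk⟩ := h
  rw [← isHanging_iff]
  rcases Nat.eq_zero_or_pos m with rfl | hm0
  -- No half-edge in between and one half-edge in between would give a letter fixed by the clockwise
  -- rotation.
  · exact absurd (hb.2.2.trans hm.2.2.symm) (Letter.clockwise_ne _)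
  · exact hk 1 le_rfl hm0

theorem isBoundaryPath_append {p q : List Z.Dart} : Z.IsBoundaryPath (p ++ q) ↔
    Z.IsBoundaryPath p ∧ Z.IsBoundaryPath q ∧
      ∀ d ∈ p.getLast?, ∀ d' ∈ q.head?, Z.BoundaryNext d d' := by
  simp only [IsBoundaryPath, List.forall_mem_append, List.isChain_append]
  tauto

theorem IsBlock.isBoundaryPath {p : List Z.Dart} (hp : Z.IsBlock p)
    (h : ∀ d ∈ p, Z.IsBoundaryDart d) : Z.IsBoundaryPath p :=
  ⟨h, (isBlock_iff.1 hp).2.imp fun _ _ => Follows.boundaryNext⟩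

theorem IsBlock.exists_leftOf_or {p : List Z.Dart} (hp : Z.IsBlock p) :
    (∃ f, ∀ d ∈ p, Z.LeftOf f d) ∨ ∀ d ∈ p, Z.IsBoundaryDart d := by
  by_cases h : ∀ d ∈ p, Z.IsBoundaryDart d
  · exact Or.inr h
  · left
    simp only [IsBoundaryDart] at h
    push Not at h
    obtain ⟨d, hd, f, hf⟩ := h
    exact ⟨f, hf.of_isChain (isBlock_iff.1 hp).2 hd⟩

/-- In a boundary reduced tiled surface there is a `4g`-gon on the left of every long block. -/
theorem BoundaryReduced.exists_leftOf_of_isLongBlock (hZ : Z.BoundaryReduced) {p : List Z.Dart}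
    (hp : Z.IsLongBlock p) : ∃ f, ∀ d ∈ p, Z.LeftOf f d :=
  hp.1.exists_leftOf_or.resolve_right fun h => (hZ p (hp.1.isBoundaryPath h)).1 hp

theorem isBlock_concat {p : List Z.Dart} {d h : Z.Dart} (hp : Z.IsBlock (p ++ [d]))
    (hf : Z.Follows d h) : Z.IsBlock (p ++ [d, h]) := by
  rw [isBlock_iff] at hp ⊢
  refine ⟨by simp, ?_⟩
  rw [show p ++ [d, h] = (p ++ [d]) ++ [h] by simp, List.isChain_append]
  exact ⟨hp.2, List.isChain_singleton _, by simpa using hf⟩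

theorem isBlock_cons {p : List Z.Dart} {d h : Z.Dart} (hp : Z.IsBlock (d :: p))
    (hf : Z.Follows h d) : Z.IsBlock (h :: d :: p) := by
  rw [isBlock_iff] at hp ⊢
  exact ⟨by simp, List.isChain_cons_cons.2 ⟨hf, hp.2⟩⟩

/-- A boundary path of a boundary reduced tiled surface that consists of blocks of lengths
`2g, 2g-1, …, 2g-1` does not extend to a chain of blocks of lengths
`2g, 2g-1, …, 2g-1, 2g`. -/
theorem BoundaryReduced.not_isBlockChain_append (hg : 0 < g) (hZ : Z.BoundaryReduced) (k : ℕ) :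
    ∀ (R P : List (List Z.Dart)) (m : ℕ),
      P.map List.length = 2 * g :: List.replicate m (2 * g - 1) →
      R.map List.length = List.replicate k (2 * g - 1) ++ [2 * g] →
      Z.IsBoundaryPath P.flatten → ¬ Z.IsBlockChain (P ++ R) := by
  induction k with
  | zero | succ k ih =>
    intro R P m hP hR hbP hB
    obtain ⟨q, R, rfl⟩ : ∃ q R', R = q :: R' := by
      cases R with
      | nil => simp at hR
      | cons q R => exact ⟨q, R, rfl⟩
    obtain ⟨P, l, rfl⟩ : ∃ P₀ l, P = P₀ ++ [l] := by
      rcases List.eq_nil_or_concat P with rfl | ⟨P₀, l, rfl⟩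
      · simp at hP
      · exact ⟨P₀, l, by simp⟩
    have hlB : Z.IsBlock l := hB.1 l (by simp)
    have hqB : Z.IsBlock q := hB.1 q (by simp)
    obtain ⟨l, d, rfl⟩ : ∃ l₀ d, l = l₀ ++ [d] := by
      rcases List.eq_nil_or_concat l with rfl | ⟨l₀, d, rfl⟩
      · exact absurd rfl hlB.1
      · exact ⟨l₀, d, by simp⟩
    obtain ⟨d', q, rfl⟩ : ∃ d' q', q = d' :: q' := List.exists_cons_of_ne_nil hqB.1
    have hc := hB.2
    rw [List.append_assoc, List.isChain_append] at hc
    obtain ⟨hcP, hcR, hcPR⟩ := hc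
    simp only [List.singleton_append, List.isChain_cons_cons] at hcR
    have hdd : Z.Between d d' 1 := hcR.1 d (by simp) d' (by simp)
    have hbd : Z.IsBoundaryDart d := hbP.1 d (by simp)
    -- An edge `h` in the gap would again be a boundary dart. Appended to the last block `l`, it
    -- gives length `2g+1` if `l` is the first block (a long block), and otherwise length `2g`,
    -- which closes a long chain early.
    have hnf : ¬ ∃ h, Z.Follows d h := by
      rintro ⟨h, hf⟩
      have hbh : Z.IsBoundaryDart h := fun f hfl => hbd f (hfl.of_follows_left hf)
      have hb2 : Z.IsBoundaryPath (P ++ [l ++ [d, h]]).flatten := by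
        rw [show (P ++ [l ++ [d, h]]).flatten = (P ++ [l ++ [d]]).flatten ++ [h] by simp,
          isBoundaryPath_append]
        refine ⟨hbP, ⟨by simpa using hbh, List.isChain_singleton _⟩, ?_⟩
        simpa [← List.append_assoc] using hf.boundaryNext
      have hblk := isBlock_concat hlB hf
      cases P with
      | nil =>
        simp only [List.nil_append, List.map_cons, List.cons.injEq] at hP
        refine (hZ _ hb2).1 ⟨by simpa using hblk, ?_⟩
        have := hP.1
        simp at this ⊢
        omega
      | cons p₀ P =>
        simp only [List.cons_append, List.map_cons, List.map_append, List.cons.injEq,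
          List.map_nil] at hP
        have hm := List.eq_replicate_iff.1 hP.2
        refine (hZ _ hb2).2 ⟨_, P.length, rfl, ⟨?_, ?_⟩, ?_⟩
        · intro x hx
          rcases List.mem_append.1 hx with hx | hx
          · exact hB.1 x (by simp at hx ⊢; tauto)
          · rw [List.mem_singleton.1 hx]
            exact hblk
        · rw [List.isChain_append]
          refine ⟨hcP, List.isChain_singleton _, ?_⟩
          intro x hx y hy e he e' he'
          simp only [List.head?_cons, Option.mem_def, Option.some.injEq] at hy
          subst hy
          refine hcPR x hx (l ++ [d]) (by simp) e he e' ?_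
          cases l <;> simpa using he'
        · have h1 := hm.2 (l ++ [d]).length (by simp)
          have h2 : P.map List.length = List.replicate P.length (2 * g - 1) := by
            rw [List.eq_replicate_iff]
            refine ⟨by simp, fun b hb => hm.2 b (by simp only [List.mem_append]; exact Or.inl hb)⟩
          simp only [List.cons_append, List.map_cons, List.map_append, List.map_nil, hP.1, h2]
          simp at h1 ⊢
          omega
    -- A polygon along the next block would have a side ending at `d'`; its reverse would fill the
    -- gap.
    have hbq : ∀ e ∈ d' :: q, Z.IsBoundaryDart e := by
      refine hqB.exists_leftOf_or.resolve_left ?_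
      rintro ⟨f, hf⟩
      obtain ⟨h, -, hh⟩ := (hf d' (by simp)).exists_follows_left
      exact hnf ⟨_, hdd.follows_rev hh⟩
    have hb2 : Z.IsBoundaryPath (P ++ [l ++ [d]] ++ [d' :: q]).flatten := by
      rw [List.flatten_append, isBoundaryPath_append]
      refine ⟨hbP, by simpa using hqB.isBoundaryPath hbq, ?_⟩
      simpa [← List.append_assoc] using hdd.boundaryNext hnf
    -- With `k + 1` the block just reached has length `2g-1` and joins the prefix; with `k = 0` it
    -- has length `2g` and completes a long chain on the boundary.
    first
    | (refine ih R (P ++ [l ++ [d]] ++ [d' :: q]) (m + 1) ?_ ?_ hb2 (by simpa using hB)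
       · rw [List.map_append, hP, List.replicate_succ']
         simp only [List.replicate_succ, List.cons_append, List.map_cons, List.cons.injEq] at hR
         simp only [List.map_cons, List.map_nil, hR.1, List.cons_append]
       · simp only [List.replicate_succ, List.cons_append, List.map_cons, List.cons.injEq] at hR
         exact hR.2)
    | (obtain rfl : R = [] := by simpa using (congrArg List.length hR)
       refine (hZ _ hb2).2 ⟨_, m, rfl, hB, ?_⟩
       rw [List.map_append, hP, hR]
       simp)

/-- In a boundary reduced tiled surface, `4g`-gons on the left of the first block of a chain of
blocks that ends like a long chain propagate to all its blocks. -/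
theorem BoundaryReduced.exists_leftOf_of_isBlockChain_cons (hg : 0 < g) (hZ : Z.BoundaryReduced)
    (k : ℕ) : ∀ (R : List (List Z.Dart)) (l : List Z.Dart), (∃ f, ∀ d ∈ l, Z.LeftOf f d) →
      R.map List.length = List.replicate k (2 * g - 1) ++ [2 * g] →
      Z.IsBlockChain (l :: R) → ∀ q ∈ R, ∃ f, ∀ d ∈ q, Z.LeftOf f d := by
  induction k with
  | zero | succ k ih =>
    intro R l ⟨f, hf⟩ hR hB
    obtain ⟨q, R, rfl⟩ : ∃ q R', R = q :: R' := by
      cases R with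
      | nil => simp at hR
      | cons q R => exact ⟨q, R, rfl⟩
    have hlB : Z.IsBlock l := hB.1 l (by simp)
    have hqB : Z.IsBlock q := hB.1 q (by simp)
    obtain ⟨hlq, hcR⟩ := List.isChain_cons_cons.1 hB.2
    have hq : ∃ f, ∀ d ∈ q, Z.LeftOf f d := by
      refine hqB.exists_leftOf_or.resolve_right fun hbq => ?_
      obtain ⟨d', q, rfl⟩ : ∃ d' q', q = d' :: q' := List.exists_cons_of_ne_nil hqB.1
      obtain ⟨h, -, hdh⟩ := (hf _ (List.getLast_mem hlB.1)).exists_follows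
      have hdd : Z.Between (l.getLast hlB.1) d' 1 :=
        hlq _ (List.getLast?_eq_some_getLast hlB.1) d' (by simp)
      have hrev := hdd.rev_follows hdh
      -- The reversed gap edge lengthens the next block by one: to `2g`, the start of a new long
      -- chain, or to `2g+1` if it was the last block.
      have hblk := isBlock_cons hqB hrev
      have hb2 : Z.IsBoundaryPath (Z.rev h :: d' :: q) := by
        refine hblk.isBoundaryPath (List.forall_mem_cons.2 ⟨fun f' hf' => ?_, hbq⟩)
        exact hbq d' (by simp) f' (hf'.of_follows hrev)
      first
      | (simp only [List.replicate_succ, List.cons_append, List.map_cons, List.cons.injEq] at hR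
         refine hZ.not_isBlockChain_append hg k R [Z.rev h :: d' :: q] 0 ?_ hR.2 (by simpa using hb2)
           ⟨?_, ?_⟩
         · have := hR.1
           simp at this ⊢
           omega
         · intro x hx
           rcases List.mem_cons.1 hx with rfl | hx
           · exact hblk
           · exact hB.1 x (List.mem_cons_of_mem _ (List.mem_cons_of_mem _ hx))
         · cases R with
           | nil => exact List.isChain_singleton _
           | cons r R =>
             rw [List.isChain_cons_cons] at hcR
             refine List.isChain_cons_cons.2 ⟨?_, hcR.2⟩
             intro e he e' he'
             exact hcR.1 e (by simpa using he) e' he')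
      | (obtain rfl : R = [] := by simpa using (congrArg List.length hR)
         refine (hZ _ hb2).1 ⟨hblk, ?_⟩
         simp at hR ⊢
         omega)
    refine List.forall_mem_cons.2 ⟨hq, ?_⟩
    first
    | (simp only [List.replicate_succ, List.cons_append, List.map_cons, List.cons.injEq] at hR
       exact ih R q hq hR.2 ⟨fun x hx => hB.1 x (List.mem_cons_of_mem _ hx), hcR⟩)
    | (obtain rfl : R = [] := by simpa using (congrArg List.length hR)
       simp)

/-- In a boundary reduced tiled surface there is a `4g`-gon on the left of every block of a
long chain. -/
theorem BoundaryReduced.exists_leftOf_of_isBlockChain (hg : 0 < g) (hZ : Z.BoundaryReduced)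
    {B : List (List Z.Dart)} {k : ℕ} (hB : Z.IsBlockChain B)
    (hlen : B.map List.length = 2 * g :: (List.replicate k (2 * g - 1) ++ [2 * g])) :
    ∀ q ∈ B, ∃ f, ∀ d ∈ q, Z.LeftOf f d := by
  obtain ⟨q, R, rfl⟩ : ∃ q R', B = q :: R' := by
    cases B with
    | nil => simp at hlen
    | cons q R => exact ⟨q, R, rfl⟩
  simp only [List.map_cons, List.cons.injEq] at hlen
  have hqB : Z.IsBlock q := hB.1 q (by simp)
  have hq : ∃ f, ∀ d ∈ q, Z.LeftOf f d := by
    refine hqB.exists_leftOf_or.resolve_right fun hbq => ?_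
    exact hZ.not_isBlockChain_append hg k R [q] 0 (by simpa using hlen.1) hlen.2
      (by simpa using hqB.isBoundaryPath hbq) hB
  exact List.forall_mem_cons.2
    ⟨hq, hZ.exists_leftOf_of_isBlockChain_cons hg k R q hq hlen.2 hB⟩

end LongBlocks

end TiledSurface

namespace TiledSurface

variable {g : ℕ}

/-! ### Morphisms carry blocks and chains to blocks and chains -/

namespace Hom

variable {Y : TiledSurface.{u} g} {Z : TiledSurface.{v} g} (φ : Hom Y Z)

/-- The action of a morphism on darts. -/
def onDart (d : Y.Dart) : Z.Dart := (φ.onE d.1, d.2)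

theorem dsrc_onDart (d : Y.Dart) : Z.dsrc (φ.onDart d) = φ.onV (Y.dsrc d) := by
  rcases d with ⟨e, _ | _⟩
  · exact φ.tgt_onE e
  · exact φ.src_onE e

theorem dtgt_onDart (d : Y.Dart) : Z.dtgt (φ.onDart d) = φ.onV (Y.dtgt d) := by
  rcases d with ⟨e, _ | _⟩
  · exact φ.src_onE e
  · exact φ.tgt_onE e

theorem letter_onDart (d : Y.Dart) : Z.letter (φ.onDart d) = Y.letter d :=
  Prod.ext (φ.label_onE d.1) rfl

theorem between_onDart {d d' : Y.Dart} {m : ℕ} (h : Y.Between d d' m) :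
    Z.Between (φ.onDart d) (φ.onDart d') m := by
  refine ⟨?_, h.2.1, ?_⟩
  · rw [dtgt_onDart, dsrc_onDart, h.1]
  · rw [letter_onDart, letter_onDart, h.2.2]

theorem isBlock_map {p : List Y.Dart} (hp : Y.IsBlock p) : Z.IsBlock (p.map φ.onDart) := by
  refine ⟨by simpa using hp.1, ?_⟩
  rw [List.isChain_map]
  exact hp.2.imp fun _ _ => φ.between_onDart

theorem isLongBlock_map {p : List Y.Dart} (hp : Y.IsLongBlock p) :
    Z.IsLongBlock (p.map φ.onDart) :=
  ⟨φ.isBlock_map hp.1, by simpa using hp.2⟩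

theorem isBlockChain_map {B : List (List Y.Dart)} (hB : Y.IsBlockChain B) :
    Z.IsBlockChain (B.map (List.map φ.onDart)) := by
  refine ⟨?_, ?_⟩
  · simp only [List.mem_map]
    rintro _ ⟨p, hp, rfl⟩
    exact φ.isBlock_map (hB.1 p hp)
  · rw [List.isChain_map]
    refine hB.2.imp fun p q h => ?_
    intro d hd d' hd'
    simp only [List.getLast?_map, List.head?_map, Option.mem_def, Option.map_eq_some_iff] at hd hd'
    obtain ⟨d, hd, rfl⟩ := hd
    obtain ⟨d', hd', rfl⟩ := hd'
    exact φ.between_onDart (h d hd d' hd')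

/-- The image of a long chain in a boundary reduced tiled surface has `4g`-gons along all its
blocks. -/
theorem exists_leftOf_of_isBlockChain (hg : 0 < g) (hZ : Z.BoundaryReduced)
    {B : List (List Y.Dart)} {k : ℕ} (hB : Y.IsBlockChain B)
    (hlen : B.map List.length = 2 * g :: (List.replicate k (2 * g - 1) ++ [2 * g])) :
    ∀ q ∈ B, ∃ f, ∀ d ∈ q, Z.LeftOf f (φ.onDart d) := by
  intro q hq
  obtain ⟨f, hf⟩ := hZ.exists_leftOf_of_isBlockChain hg (k := k) (φ.isBlockChain_map hB) (by
    rw [← hlen, List.map_map]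
    exact List.map_congr_left fun x _ => by simp) _ (List.mem_map_of_mem hq)
  exact ⟨f, fun d hd => hf _ (List.mem_map_of_mem hd)⟩

/-- The image of a long block or a long chain in a boundary reduced tiled surface has `4g`-gons
on the left of all its darts. -/
theorem exists_leftOf_onDart (hg : 0 < g) (hZ : Z.BoundaryReduced) {p : List Y.Dart}
    (hp : Y.IsLongBlock p ∨ Y.IsLongChain p) : ∀ d ∈ p, ∃ f, Z.LeftOf f (φ.onDart d) := by
  rcases hp with hp | ⟨B, k, rfl, hB, hlen⟩
  · obtain ⟨f, hf⟩ := hZ.exists_leftOf_of_isLongBlock (φ.isLongBlock_map hp)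
    exact fun d hd => ⟨f, hf _ (List.mem_map_of_mem hd)⟩
  · intro d hd
    obtain ⟨q, hq, hdq⟩ := List.mem_flatten.1 hd
    obtain ⟨f, hf⟩ := φ.exists_leftOf_of_isBlockChain hg hZ hB hlen q hq
    exact ⟨f, hf d hdq⟩

end Hom

/-! ### Sub-complexes and the effect of one step -/

namespace Subcomplex

variable {Z : TiledSurface.{u} g}

/-- The inclusion of a sub-complex. -/
def incl (X : Subcomplex Z) : Hom X.toTiledSurface Z where
  onV := Subtype.val
  onE := Subtype.val
  onF := Subtype.val
  src_onE _ := rfl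
  tgt_onE _ := rfl
  label_onE _ := rfl
  bdry_onF f := (X.map_subBdry f).symm

theorem toAmbient_injective (X : Subcomplex Z) : Function.Injective X.toAmbient := fun d d' h => by
  obtain ⟨h1, h2⟩ := Prod.ext_iff.1 h
  exact Prod.ext (Subtype.ext h1) h2

/-- The inclusion of a sub-complex in a larger one. -/
def inclOfLE {X W : Subcomplex Z} (h : X ≤ W) : Hom X.toTiledSurface W.toTiledSurface where
  onV := Set.inclusion h.1
  onE := Set.inclusion h.2.1
  onF := Set.inclusion h.2.2
  src_onE _ := rfl
  tgt_onE _ := rfl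
  label_onE _ := rfl
  bdry_onF f := by
    apply List.map_injective_iff.2 W.toAmbient_injective
    refine (W.map_subBdry _).trans ((X.map_subBdry f).symm.trans ?_)
    exact (List.map_map (f := Prod.map (Set.inclusion h.2.1) id) (g := W.toAmbient)).symm

theorem leftOf_iff (X : Subcomplex Z) {f : X.faces} {d : X.toTiledSurface.Dart} :
    X.toTiledSurface.LeftOf f d ↔ Z.LeftOf f.1 (X.toAmbient d) := by
  change d ∈ X.subBdry f ↔ X.toAmbient d ∈ Z.bdry f.1
  rw [← X.map_subBdry f]
  exact (List.mem_map_of_injective X.toAmbient_injective).symm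

theorem le_refl (X : Subcomplex Z) : X ≤ X := ⟨subset_rfl, subset_rfl, subset_rfl⟩

theorem le_trans {X X' X'' : Subcomplex Z} (h : X ≤ X') (h' : X' ≤ X'') : X ≤ X'' :=
  ⟨h.1.trans h'.1, h.2.1.trans h'.2.1, h.2.2.trans h'.2.2⟩

theorem le_antisymm {X X' : Subcomplex Z} (h : X ≤ X') (h' : X' ≤ X) : X = X' :=
  Subcomplex.ext (h.1.antisymm h'.1) (h.2.1.antisymm h'.2.1) (h.2.2.antisymm h'.2.2)

theorem le_adjoin (X : Subcomplex Z) (S : Set Z.F) : X ≤ X.adjoin S :=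
  ⟨Set.subset_union_left, Set.subset_union_left, Set.subset_union_left⟩

theorem adjoin_le {X W : Subcomplex Z} {S : Set Z.F} (h : X ≤ W) (hS : S ⊆ W.faces) :
    X.adjoin S ≤ W := by
  refine ⟨Set.union_subset h.1 ?_, Set.union_subset h.2.1 ?_, Set.union_subset h.2.2 hS⟩
  · rintro v ⟨f, hf, d, hd, rfl | rfl⟩
    · exact W.src_mem _ (W.bdry_mem f (hS hf) d hd)
    · exact W.tgt_mem _ (W.bdry_mem f (hS hf) d hd)
  · rintro e ⟨f, hf, d, hd, rfl⟩
    exact W.bdry_mem f (hS hf) d hd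

/-- A boundary reduced sub-complex that contains `X` contains all `4g`-gons along long blocks and
long chains of `X`. -/
theorem facesAlong_subset (hg : 0 < g) {X W : Subcomplex Z} (h : X ≤ W)
    (hW : W.toTiledSurface.BoundaryReduced) {p : List X.toTiledSurface.Dart}
    (hp : X.toTiledSurface.IsLongBlock p ∨ X.toTiledSurface.IsLongChain p) :
    X.facesAlong p ⊆ W.faces := by
  rintro f ⟨d, hd, hf⟩
  -- Working with the inclusion into `W` rather than `Z` produces a polygon of `W`, which must be
  -- `f` by uniqueness.
  obtain ⟨f', hf'⟩ := (inclOfLE h).exists_leftOf_onDart hg hW hp d hd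
  rw [hf.face_unique ((W.leftOf_iff).1 hf')]
  exact f'.2

theorem Step.le {X X' : Subcomplex Z} (h : X.Step X') : X ≤ X' := by
  obtain ⟨p, -, -, rfl⟩ := h
  exact X.le_adjoin _

theorem Step.le_of_boundaryReduced (hg : 0 < g) {X X' W : Subcomplex Z} (h : X.Step X')
    (hXW : X ≤ W) (hW : W.toTiledSurface.BoundaryReduced) : X' ≤ W := by
  obtain ⟨p, -, hp, rfl⟩ := h
  exact adjoin_le hXW (facesAlong_subset hg hXW hW hp)

theorem facesAlong_finite (X : Subcomplex Z) (p : List X.toTiledSurface.Dart) :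
    (X.facesAlong p).Finite := by
  have : X.facesAlong p = ⋃ d ∈ {d | d ∈ p}, {f | Z.LeftOf f (X.toAmbient d)} := by
    ext f
    simp [facesAlong]
  rw [this]
  refine Set.Finite.biUnion (List.finite_toSet p) fun d _ => Set.Subsingleton.finite ?_
  exact fun f hf f' hf' => LeftOf.face_unique hf hf'

theorem isCompact_iff (X : Subcomplex Z) :
    X.toTiledSurface.IsCompact ↔ X.verts.Finite ∧ X.edges.Finite ∧ X.faces.Finite := Iff.rfl

theorem isCompact_adjoin {X : Subcomplex Z} (hX : X.toTiledSurface.IsCompact) {S : Set Z.F}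
    (hS : S.Finite) : (X.adjoin S).toTiledSurface.IsCompact := by
  rw [isCompact_iff] at hX ⊢
  have hD : {d | ∃ f ∈ S, d ∈ Z.bdry f}.Finite := by
    have : {d | ∃ f ∈ S, d ∈ Z.bdry f} = ⋃ f ∈ S, {d | d ∈ Z.bdry f} := by
      ext d
      simp
    rw [this]
    exact hS.biUnion fun f _ => List.finite_toSet _
  refine ⟨hX.1.union ?_, hX.2.1.union ?_, hX.2.2.union hS⟩
  · refine ((hD.image fun d => Z.src d.1).union (hD.image fun d => Z.tgt d.1)).subset ?_
    rintro v ⟨f, hf, d, hd, rfl | rfl⟩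
    · exact Or.inl ⟨d, ⟨f, hf, hd⟩, rfl⟩
    · exact Or.inr ⟨d, ⟨f, hf, hd⟩, rfl⟩
  · refine (hD.image fun d => d.1).subset ?_
    rintro v ⟨f, hf, d, hd, rfl⟩
    exact ⟨d, ⟨f, hf, hd⟩, rfl⟩

theorem Step.isCompact {X X' : Subcomplex Z} (h : X.Step X') (hX : X.toTiledSurface.IsCompact) :
    X'.toTiledSurface.IsCompact := by
  obtain ⟨p, -, -, rfl⟩ := h
  exact isCompact_adjoin hX (X.facesAlong_finite p)

/-! ### The change of the boundary length -/

/-- Counting inside the darts of `Z` makes the boundary lengths of different sub-complexes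
comparable. -/
theorem boundaryLength_eq (X : Subcomplex Z) : X.toTiledSurface.boundaryLength =
    {d : Z.Dart | d.1 ∈ X.edges ∧ ∀ f ∈ X.faces, ¬ Z.LeftOf f d}.ncard := by
  refine (Set.ncard_image_of_injective {d : X.toTiledSurface.Dart |
    X.toTiledSurface.IsBoundaryDart d} X.toAmbient_injective).symm.trans ?_
  congr 1
  ext d
  constructor
  · rintro ⟨d, hd, rfl⟩
    exact ⟨d.1.2, fun f hf hl => hd ⟨f, hf⟩ (X.leftOf_iff.2 hl)⟩
  · rintro ⟨hd, hf⟩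
    exact ⟨(⟨d.1, hd⟩, d.2), fun f hl => hf f.1 f.2 (X.leftOf_iff.1 hl), rfl⟩

section Count

open scoped Classical in
/-- The darts along the boundary of `f` that belong to `X`. -/
noncomputable def oldDarts (X : Subcomplex Z) (f : Z.F) : Finset Z.Dart :=
  (Z.bdry f).toFinset.filter fun d => d.1 ∈ X.edges

open scoped Classical in
/-- The darts along the boundary of `f` that do not belong to `X` and have `4g`-gons of `S` on
their right. -/
noncomputable def innerDarts (X : Subcomplex Z) (S : Set Z.F) (f : Z.F) : Finset Z.Dart :=
  (Z.bdry f).toFinset.filter fun d => d.1 ∉ X.edges ∧ ∃ f' ∈ S, Z.LeftOf f' (Z.rev d)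

open scoped Classical in
/-- The darts along the boundary of `f` that do not belong to `X` and have no `4g`-gon of `S` on
their right. -/
noncomputable def outerDarts (X : Subcomplex Z) (S : Set Z.F) (f : Z.F) : Finset Z.Dart :=
  (Z.bdry f).toFinset.filter fun d => d.1 ∉ X.edges ∧ ¬ ∃ f' ∈ S, Z.LeftOf f' (Z.rev d)

theorem mem_oldDarts {X : Subcomplex Z} {f : Z.F} {d : Z.Dart} :
    d ∈ X.oldDarts f ↔ Z.LeftOf f d ∧ d.1 ∈ X.edges := by
  simp only [oldDarts, Finset.mem_filter, List.mem_toFinset, LeftOf.eq_def Z f d]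

theorem mem_innerDarts {X : Subcomplex Z} {S : Set Z.F} {f : Z.F} {d : Z.Dart} :
    d ∈ X.innerDarts S f ↔
      Z.LeftOf f d ∧ d.1 ∉ X.edges ∧ ∃ f' ∈ S, Z.LeftOf f' (Z.rev d) := by
  simp only [innerDarts, Finset.mem_filter, List.mem_toFinset, LeftOf.eq_def Z f d]

theorem mem_outerDarts {X : Subcomplex Z} {S : Set Z.F} {f : Z.F} {d : Z.Dart} :
    d ∈ X.outerDarts S f ↔
      Z.LeftOf f d ∧ d.1 ∉ X.edges ∧ ¬ ∃ f' ∈ S, Z.LeftOf f' (Z.rev d) := by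
  simp only [outerDarts, Finset.mem_filter, List.mem_toFinset, LeftOf.eq_def Z f d]

theorem card_oldDarts_add (X : Subcomplex Z) (S : Set Z.F) (f : Z.F) :
    (X.oldDarts f).card + ((X.innerDarts S f).card + (X.outerDarts S f).card) = 4 * g := by
  classical
  rw [← bdry_length f, ← List.toFinset_card_of_nodup (bdry_nodup f)]
  rw [← Finset.card_filter_add_card_filter_not (s := (Z.bdry f).toFinset)
    (fun d => d.1 ∈ X.edges)]
  rw [← Finset.card_filter_add_card_filter_not 
    (s := (Z.bdry f).toFinset.filter fun d => d.1 ∉ X.edges) (fun d => ∃ f' ∈ S, Z.LeftOf f' (Z.rev d))]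
  simp only [Finset.filter_filter]
  unfold oldDarts innerDarts outerDarts
  congr!

/-- If every `4g`-gon of `S` has at least as many old darts as outer ones, with a surplus of two
in total, then adding `S` reduces the boundary length by two. -/
theorem boundaryLength_adjoin (X : Subcomplex Z) (hX : X.edges.Finite) (S : Finset Z.F)
    (hS : ∀ f ∈ S, f ∉ X.faces)
    (hle : ∑ f ∈ S, (X.outerDarts S f).card + 2 ≤ ∑ f ∈ S, (X.oldDarts f).card) :
    (X.adjoin S).toTiledSurface.boundaryLength + 2 ≤ X.toTiledSurface.boundaryLength := by
  classical
  rw [boundaryLength_eq, boundaryLength_eq]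
  set b : Set Z.Dart := {d | d.1 ∈ X.edges ∧ ∀ f ∈ X.faces, ¬ Z.LeftOf f d} with hb
  -- Finiteness is essential here, as `Set.ncard` is `0` on infinite sets.
  have hbfin : b.Finite := (hX.prod (Set.finite_univ (α := Bool))).subset fun d hd => ⟨hd.1, trivial⟩
  have hold : (S.biUnion X.oldDarts : Set Z.Dart) ⊆ b := by
    intro d hd
    simp only [Finset.coe_biUnion, Set.mem_iUnion, Finset.mem_coe, mem_oldDarts] at hd
    obtain ⟨f, hf, hl, hd⟩ := hd
    exact ⟨hd, fun f' hf' hl' => hS f hf (hl.face_unique hl' ▸ hf')⟩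
  have hsub : {d : Z.Dart | d.1 ∈ (X.adjoin S).edges ∧ ∀ f ∈ (X.adjoin S).faces, ¬ Z.LeftOf f d} ⊆
      (b \ (S.biUnion X.oldDarts : Finset Z.Dart)) ∪
        ((S.biUnion (X.outerDarts S)).image Z.rev : Finset Z.Dart) := by
    rintro d ⟨hd, hf⟩
    by_cases hdX : d.1 ∈ X.edges
    · left
      refine ⟨⟨hdX, fun f hfX => hf f (Or.inl hfX)⟩, ?_⟩
      simp only [Finset.coe_biUnion, Set.mem_iUnion, Finset.mem_coe, mem_oldDarts]
      rintro ⟨f, hfS, hl, -⟩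
      exact hf f (Or.inr hfS) hl
    · right
      rcases hd with hd | ⟨f, hfS, d', hd', he⟩
      · exact absurd hd hdX
      -- A new boundary dart lies on the edge of a side `d'` of an added polygon and cannot be that
      -- side itself, so it is its reverse.
      have hdd : d' = Z.rev d := by
        rcases Bool.eq_or_eq_not d'.2 d.2 with h | h
        · exact absurd (show Z.LeftOf f d from (Prod.ext he.symm h : d' = d) ▸ hd')
            (hf f (Or.inr hfS))
        · exact Prod.ext he.symm h
      subst hdd
      simp only [Finset.coe_image, Finset.coe_biUnion]
      refine ⟨Z.rev d, ?_, rev_rev d⟩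
      simp only [Set.mem_iUnion, Finset.mem_coe, mem_outerDarts, rev_rev]
      exact ⟨f, hfS, hd', hdX, fun ⟨f', hf', hl⟩ => hf f' (Or.inr hf') hl⟩
  have h1 := Set.ncard_le_ncard hsub ((hbfin.subset Set.sdiff_subset).union (Finset.finite_toSet _))
  have h2 := Set.ncard_union_le (b \ (S.biUnion X.oldDarts : Finset Z.Dart))
    ((S.biUnion (X.outerDarts S)).image Z.rev : Finset Z.Dart)
  have h3 := Set.ncard_sdiff_add_ncard_of_subset hold hbfin
  rw [Set.ncard_coe_finset] at h2 h3
  have h4 : ((S.biUnion (X.outerDarts S)).image Z.rev).card ≤ _ :=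
    Finset.card_image_le.trans Finset.card_biUnion_le
  -- The removed darts must be counted exactly, which holds since a dart has only one polygon on its
  -- left; for outer darts an upper bound is enough.
  have h5 : (S.biUnion X.oldDarts).card = ∑ f ∈ S, (X.oldDarts f).card := by
    refine Finset.card_biUnion fun f _ f' _ hff => Finset.disjoint_left.2 fun d hd hd' => hff ?_
    exact (mem_oldDarts.1 hd).1.face_unique (mem_oldDarts.1 hd').1
  omega

theorem boundaryLength_adjoin_of_faces (X : Subcomplex Z) (hX : X.edges.Finite) {S : Set Z.F}
    (hfin : S.Finite) (hS : ∀ f ∈ S, f ∉ X.faces) {f₀ f₁ : Z.F} (hf₀ : f₀ ∈ S) (hf₁ : f₁ ∈ S)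
    (hmid : ∀ f ∈ S, f ≠ f₀ → f ≠ f₁ → (X.outerDarts S f).card ≤ (X.oldDarts f).card)
    (h₀ : (X.outerDarts S f₀).card + 1 ≤ (X.oldDarts f₀).card)
    (h₁ : (X.outerDarts S f₁).card + 1 ≤ (X.oldDarts f₁).card)
    (h₀₁ : f₀ = f₁ → (X.outerDarts S f₀).card + 2 ≤ (X.oldDarts f₀).card) :
    (X.adjoin S).toTiledSurface.boundaryLength + 2 ≤ X.toTiledSurface.boundaryLength := by
  classical
  obtain ⟨S, rfl⟩ : ∃ T : Finset Z.F, S = T := ⟨hfin.toFinset, by simp⟩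
  refine X.boundaryLength_adjoin hX S hS ?_
  -- The surplus of two is spread as one unit on each end polygon, both falling on the same one if
  -- they coincide.
  have h2 : ∑ f ∈ S, ((if f = f₀ then 1 else 0) + (if f = f₁ then 1 else 0)) = 2 := by
    rw [Finset.sum_add_distrib, Finset.sum_ite_eq', Finset.sum_ite_eq', if_pos (Finset.mem_coe.1 hf₀),
      if_pos (Finset.mem_coe.1 hf₁)]
  rw [← h2, ← Finset.sum_add_distrib]
  refine Finset.sum_le_sum fun f hf => ?_
  split_ifs with ha hb hb
  · subst ha
    exact h₀₁ hb
  · subst ha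
    exact h₀
  · subst hb
    omega
  · exact hmid f hf ha hb

end Count

end Subcomplex
end TiledSurface

namespace TiledSurface

variable {g : ℕ}

namespace Subcomplex

variable {Z : TiledSurface.{u} g}

/-! ### Counting sides along long blocks and long chains -/

theorem not_mem_faces_of_facesAlong {X : Subcomplex Z} {p : List X.toTiledSurface.Dart}
    (hp : X.toTiledSurface.IsBoundaryPath p) : ∀ f ∈ X.facesAlong p, f ∉ X.faces := by
  rintro f ⟨d, hd, hl⟩ hf
  exact hp.1 d hd ⟨f, hf⟩ (X.leftOf_iff.2 hl)

/-- The darts of a block of `X` along a `4g`-gon are old darts of this `4g`-gon. -/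
theorem length_le_card_oldDarts {X : Subcomplex Z} {q : List X.toTiledSurface.Dart}
    (hq : X.toTiledSurface.IsBlock q) (hlen : q.length ≤ 4 * g) {f : Z.F}
    (hf : ∀ d ∈ q, Z.LeftOf f (X.incl.onDart d)) : q.length ≤ (X.oldDarts f).card := by
  classical
  have hn : (q.map X.incl.onDart).Nodup :=
    nodup_of_isChain_follows (isBlock_iff.1 (X.incl.isBlock_map hq)).2 (by simpa using hlen)
  rw [← List.length_map X.incl.onDart, ← List.toFinset_card_of_nodup hn]
  refine Finset.card_le_card fun d hd => ?_
  obtain ⟨e, he, rfl⟩ := List.mem_map.1 (List.mem_toFinset.1 hd)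
  exact mem_oldDarts.2 ⟨hf e he, e.1.2⟩

theorem boundaryLength_adjoin_of_isLongBlock (hg : 2 ≤ g) (hZ : Z.BoundaryReduced)
    {X : Subcomplex Z} (hX : X.edges.Finite) {p : List X.toTiledSurface.Dart}
    (hb : X.toTiledSurface.IsBoundaryPath p) (hp : X.toTiledSurface.IsLongBlock p) :
    (X.adjoin (X.facesAlong p)).toTiledSurface.boundaryLength + 2
      ≤ X.toTiledSurface.boundaryLength := by
  obtain ⟨f, hf⟩ := hZ.exists_leftOf_of_isLongBlock (X.incl.isLongBlock_map hp)
  have hf' : ∀ d ∈ p, Z.LeftOf f (X.incl.onDart d) := fun d hd => hf _ (List.mem_map_of_mem hd)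
  have huniq : ∀ f' ∈ X.facesAlong p, f' = f := fun f' ⟨d, hd, hl⟩ => hl.face_unique (hf' d hd)
  have hfS : f ∈ X.facesAlong p := by
    obtain ⟨d, hd⟩ := List.exists_mem_of_ne_nil p hp.1.1
    exact ⟨d, hd, hf' d hd⟩
  have hcard : 2 * g + 1 ≤ (X.oldDarts f).card := by
    -- A long block has no upper length bound and might repeat darts; its first `2g+1` darts are
    -- distinct.
    have hlen : (p.take (2 * g + 1)).length = 2 * g + 1 := by
      rw [List.length_take]
      exact min_eq_left hp.2
    rw [← hlen]
    refine length_le_card_oldDarts ⟨fun h => ?_, hp.1.2.take _⟩ (by omega)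
      fun d hd => hf' d (List.mem_of_mem_take hd)
    rw [h] at hlen
    simp at hlen
  have hsum := X.card_oldDarts_add (X.facesAlong p) f
  exact X.boundaryLength_adjoin_of_faces hX (X.facesAlong_finite p)
    (not_mem_faces_of_facesAlong hb) hfS hfS
    (fun f' h' hne => absurd (huniq f' h') hne) (by omega) (by omega) (fun _ => by omega)

theorem boundaryLength_adjoin_of_isLongChain (hg : 2 ≤ g) (hZ : Z.BoundaryReduced)
    {X : Subcomplex Z} (hX : X.edges.Finite) {p : List X.toTiledSurface.Dart}
    (hb : X.toTiledSurface.IsBoundaryPath p) (hp : X.toTiledSurface.IsLongChain p) :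
    (X.adjoin (X.facesAlong p)).toTiledSurface.boundaryLength + 2
      ≤ X.toTiledSurface.boundaryLength := by
  classical
  obtain ⟨B, k, rfl, hB, hlen⟩ := hp
  have hface : ∀ q ∈ B, ∃ f, ∀ d ∈ q, Z.LeftOf f (X.incl.onDart d) :=
    X.incl.exists_leftOf_of_isBlockChain (by omega) hZ hB hlen
  set S := X.facesAlong B.flatten with hS
  have hmemS : ∀ q ∈ B, ∀ f, (∀ d ∈ q, Z.LeftOf f (X.incl.onDart d)) → f ∈ S := by
    intro q hq f hf
    obtain ⟨d, hd⟩ := List.exists_mem_of_ne_nil q (hB.1 q hq).1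
    exact ⟨d, List.mem_flatten.2 ⟨q, hq, hd⟩, hf d hd⟩
  have hn : B.length = k + 2 := by
    have := congrArg List.length hlen
    simpa using this
  have hlen0 : B[0].length = 2 * g := by
    have := congrArg (fun l => l[0]?) hlen
    simpa [hn] using this
  have hlen1 : B[k + 1].length = 2 * g := by
    have := congrArg (fun l => l[k + 1]?) hlen
    simpa [hn] using this
  have hlenm : ∀ i (hi : i < B.length), 2 * g - 1 ≤ B[i].length ∧ B[i].length ≤ 2 * g := by
    intro i hi
    have h : B[i].length ∈ B.map List.length := List.mem_map_of_mem (List.getElem_mem hi)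
    rw [hlen] at h
    simp only [List.mem_cons, List.mem_append, List.mem_replicate, List.not_mem_nil, or_false] at h
    omega
  have hne : [] ∉ B := fun h => (hB.1 [] h).1 rfl
  have hchain : ∀ i (hi : i < B.length), (B[i].map X.incl.onDart).IsChain Z.Follows := fun i hi =>
    (isBlock_iff.1 (X.incl.isBlock_map (hB.1 _ (List.getElem_mem hi)))).2
  -- the hanging half-edge between successive blocks is part of an edge of the ambient surface
  have hgap : ∀ i (hi : i + 1 < B.length), ∃ h : Z.Dart, h.1 ∉ X.edges ∧
      (∀ d ∈ B[i].getLast?, Z.Follows (X.incl.onDart d) h) ∧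
      (∀ d ∈ B[i + 1].head?, Z.Follows (Z.rev h) (X.incl.onDart d)) := by
    intro i hi
    have hcons := List.isChain_iff_getElem.1 hB.2 i hi
    have hnext := List.isChain_iff_getElem.1 ((List.isChain_flatten hne).1 hb.2).2 i hi
    have h0 : B[i] ≠ [] := (hB.1 _ (List.getElem_mem _)).1
    obtain ⟨d', q', hq'⟩ := List.exists_cons_of_ne_nil (hB.1 _ (List.getElem_mem hi)).1
    have hlast : B[i].getLast? = some (B[i].getLast h0) := List.getLast?_eq_some_getLast h0
    have hhead : B[i + 1].head? = some d' := by rw [hq']; rfl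
    have hbt := hcons _ hlast _ hhead
    have hbn := (hnext _ hlast _ hhead).not_exists_follows hbt
    obtain ⟨f, hf⟩ := hface B[i] (List.getElem_mem _)
    obtain ⟨h, -, hh⟩ := (hf _ (List.getLast_mem h0)).exists_follows
    refine ⟨h, fun hX => hbn ⟨(⟨h.1, hX⟩, h.2), ?_, hh.2⟩, ?_, ?_⟩
    · apply Subtype.ext
      refine (X.coe_dartTgt _).trans (hh.1.trans (X.coe_dartSrc (⟨h.1, hX⟩, h.2)).symm)
    · intro d hd
      obtain rfl := Option.some.inj (hlast.symm.trans hd)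
      exact hh
    · intro d hd
      obtain rfl := Option.some.inj (hhead.symm.trans hd)
      exact (X.incl.between_onDart hbt).rev_follows hh
  -- The edge in the gap is a side of the polygon along `B[i]`, and its reverse is a side of the
  -- polygon along `B[i + 1]`; hence it is inner for both.
  have hafter : ∀ i (hi : i + 1 < B.length) f, (∀ d ∈ B[i], Z.LeftOf f (X.incl.onDart d)) →
      ∃ h ∈ X.innerDarts S f, (B[i].map X.incl.onDart ++ [h]).IsChain Z.Follows := by
    intro i hi f hf
    obtain ⟨h, hhX, h1, h2⟩ := hgap i hi
    obtain ⟨f', hf'⟩ := hface B[i + 1] (List.getElem_mem _)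
    have h0 : B[i] ≠ [] := (hB.1 _ (List.getElem_mem _)).1
    obtain ⟨d', q', hq'⟩ := List.exists_cons_of_ne_nil (hB.1 _ (List.getElem_mem hi)).1
    refine ⟨h, mem_innerDarts.2 ⟨?_, hhX, f', hmemS _ (List.getElem_mem _) f' hf', ?_⟩, ?_⟩
    · exact (hf _ (List.getLast_mem h0)).of_follows
        (h1 _ (List.getLast?_eq_some_getLast h0))
    · exact (hf' d' (by rw [hq']; simp)).of_follows_left (h2 d' (by rw [hq']; rfl))
    · rw [List.isChain_append]
      refine ⟨hchain i _, List.isChain_singleton _, ?_⟩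
      intro d hd e he
      simp only [List.getLast?_map, List.head?_cons, Option.mem_def, Option.map_eq_some_iff,
        Option.some.injEq] at hd he
      obtain ⟨d, hd, rfl⟩ := hd
      subst he
      exact h1 d hd
  have hbefore : ∀ i (hi : i + 1 < B.length) f, (∀ d ∈ B[i + 1], Z.LeftOf f (X.incl.onDart d)) →
      ∃ h ∈ X.innerDarts S f, (h :: B[i + 1].map X.incl.onDart).IsChain Z.Follows := by
    intro i hi f hf
    obtain ⟨h, hhX, h1, h2⟩ := hgap i hi
    obtain ⟨f', hf'⟩ := hface B[i] (List.getElem_mem _)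
    have h0 : B[i] ≠ [] := (hB.1 _ (List.getElem_mem _)).1
    have hc := hchain (i + 1) hi
    obtain ⟨d', q', hq'⟩ := List.exists_cons_of_ne_nil (hB.1 _ (List.getElem_mem hi)).1
    have hfol := h2 d' (by rw [hq']; rfl)
    refine ⟨Z.rev h, mem_innerDarts.2 ⟨?_, hhX, f', hmemS _ (List.getElem_mem _) f' hf', ?_⟩, ?_⟩
    · exact (hf d' (by rw [hq']; simp)).of_follows_left hfol
    · rw [rev_rev]
      exact (hf' _ (List.getLast_mem h0)).of_follows (h1 _ (List.getLast?_eq_some_getLast h0))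
    · rw [hq', List.map_cons] at hc ⊢
      exact List.isChain_cons_cons.2 ⟨hfol, hc⟩
  have hold : ∀ i (hi : i < B.length) f, (∀ d ∈ B[i], Z.LeftOf f (X.incl.onDart d)) →
      B[i].length ≤ (X.oldDarts f).card := fun i hi f hf =>
    length_le_card_oldDarts (hB.1 _ (List.getElem_mem hi)) (by have := hlenm i hi; omega) hf
  obtain ⟨f₀, hf₀⟩ := hface B[0] (List.getElem_mem _)
  obtain ⟨f₁, hf₁⟩ := hface B[k + 1] (List.getElem_mem _)
  obtain ⟨h₀, hh₀, hc₀⟩ := hafter 0 (by omega) f₀ hf₀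
  obtain ⟨h₁, hh₁, hc₁⟩ := hbefore k (by omega) f₁ hf₁
  have hx₀ := hold 0 (by omega) f₀ hf₀
  have hx₁ := hold (k + 1) (by omega) f₁ hf₁
  have hsum := X.card_oldDarts_add S
  have hi₀ : 1 ≤ (X.innerDarts S f₀).card := Finset.card_pos.2 ⟨_, hh₀⟩
  have hi₁ : 1 ≤ (X.innerDarts S f₁).card := Finset.card_pos.2 ⟨_, hh₁⟩
  refine X.boundaryLength_adjoin_of_faces hX (X.facesAlong_finite _)
    (not_mem_faces_of_facesAlong hb) (hmemS _ (List.getElem_mem _) f₀ hf₀)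
    (hmemS _ (List.getElem_mem _) f₁ hf₁) ?_ ?_ ?_ ?_
  · rintro f ⟨d, hd, hl⟩ hne₀ hne₁
    obtain ⟨q, hq, hdq⟩ := List.mem_flatten.1 hd
    obtain ⟨i, hi, rfl⟩ := List.getElem_of_mem hq
    have hf : ∀ d ∈ B[i], Z.LeftOf f (X.incl.onDart d) := by
      obtain ⟨f', hf'⟩ := hface _ hq
      rwa [hl.face_unique (hf' d hdq)]
    have hi0 : i ≠ 0 := by
      rintro rfl
      exact hne₀ (hl.face_unique (hf₀ d hdq))
    have hi1 : i ≠ k + 1 := by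
      rintro rfl
      exact hne₁ (hl.face_unique (hf₁ d hdq))
    obtain ⟨j, rfl⟩ := Nat.exists_eq_succ_of_ne_zero hi0
    obtain ⟨h, hh, hc⟩ := hafter (j + 1) (by omega) f hf
    obtain ⟨h', hh', hc'⟩ := hbefore j (by omega) f hf
    have hl' := hlenm (j + 1) (by omega)
    -- The gap edges before and after a middle block are distinct, since together with the block
    -- they form a chain of at most `4g` darts.
    have hnd : (h' :: (B[j + 1].map X.incl.onDart ++ [h])).Nodup := by
      refine nodup_of_isChain_follows ?_ (by simp; omega)
      obtain ⟨e, q, hq⟩ := List.exists_cons_of_ne_nil (hB.1 _ (List.getElem_mem hi)).1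
      rw [hq, List.map_cons] at hc hc' ⊢
      exact List.isChain_cons_cons.2 ⟨(List.isChain_cons_cons.1 hc').1, hc⟩
    have hhh : h' ≠ h := fun h => by simp [h] at hnd
    have h2 : 2 ≤ (X.innerDarts S f).card := by
      rw [← Finset.card_pair hhh]
      refine Finset.card_le_card fun e he => ?_
      rcases Finset.mem_insert.1 he with rfl | he
      · exact hh'
      · rwa [Finset.mem_singleton.1 he]
    have h3 := hold (j + 1) (by omega) f hf
    have h4 := hsum f
    omega
  · have h4 := hsum f₀
    omega
  · have h4 := hsum f₁
    omega
  · rintro rfl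
    have h4 := hsum f₀
    -- When one polygon carries both end blocks, two distinct gap darts give two inner sides. If
    -- they coincide, the last block starts right after the first one and this dart, so its first
    -- dart is one more old side, making at least `2g+1`.
    by_cases hhh : h₀ = h₁
    · subst hhh
      obtain ⟨e, q, hq⟩ := List.exists_cons_of_ne_nil
        (hB.1 _ (List.getElem_mem (by omega : k + 1 < B.length))).1
      have hfol : Z.Follows h₀ (X.incl.onDart e) := by
        rw [hq, List.map_cons] at hc₁
        exact (List.isChain_cons_cons.1 hc₁).1
      have hnd : (B[0].map X.incl.onDart ++ [h₀] ++ [X.incl.onDart e]).Nodup := by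
        refine nodup_of_isChain_follows ?_ (by simp; omega)
        rw [List.isChain_append]
        exact ⟨hc₀, List.isChain_singleton _, by simpa using hfol⟩
      have hnd' : (X.incl.onDart e :: B[0].map X.incl.onDart).Nodup := by
        refine List.Nodup.sublist ?_ (List.nodup_append_comm.1 hnd)
        simp
      have h5 : 2 * g + 1 ≤ (X.oldDarts f₀).card := by
        rw [show 2 * g + 1 = (X.incl.onDart e :: B[0].map X.incl.onDart).length by simp [hlen0],
          ← List.toFinset_card_of_nodup hnd']
        refine Finset.card_le_card fun x hx => ?_
        rcases List.mem_cons.1 (List.mem_toFinset.1 hx) with rfl | hx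
        · exact mem_oldDarts.2 ⟨hf₁ e (by rw [hq]; simp), e.1.2⟩
        · obtain ⟨d, hd, rfl⟩ := List.mem_map.1 hx
          exact mem_oldDarts.2 ⟨hf₀ d hd, d.1.2⟩
      omega
    · have h2 : 2 ≤ (X.innerDarts S f₀).card := by
        rw [← Finset.card_pair hhh]
        refine Finset.card_le_card fun e he => ?_
        rcases Finset.mem_insert.1 he with rfl | he
        · exact hh₀
        · rwa [Finset.mem_singleton.1 he]
      omega

/-- Adding all `4g`-gons along a long block or a long chain reduces the boundary length. -/
theorem Step.boundaryLength_add_two_le (hg : 2 ≤ g) (hZ : Z.BoundaryReduced)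
    {X X' : Subcomplex Z} (hX : X.toTiledSurface.IsCompact) (h : X.Step X') :
    X'.toTiledSurface.boundaryLength + 2 ≤ X.toTiledSurface.boundaryLength := by
  obtain ⟨p, hb, hp | hp, rfl⟩ := h
  · exact boundaryLength_adjoin_of_isLongBlock hg hZ hX.2.1 hb hp
  · exact boundaryLength_adjoin_of_isLongChain hg hZ hX.2.1 hb hp

/-! ### Termination and identification of the closure -/

theorem exists_step {X : Subcomplex Z} (h : ¬ X.toTiledSurface.BoundaryReduced) :
    ∃ X', X.Step X' := by
  simp only [BoundaryReduced] at h
  push Not at h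
  obtain ⟨p, hp, h⟩ := h
  exact ⟨_, p, hp, by tauto, rfl⟩

/-- A compact sub-complex of a boundary reduced tiled surface becomes boundary reduced after
finitely many steps. -/
theorem exists_steps (hg : 2 ≤ g) (hZ : Z.BoundaryReduced) (N : ℕ) :
    ∀ X₀ : Subcomplex Z, X₀.toTiledSurface.IsCompact → X₀.toTiledSurface.boundaryLength ≤ N →
      ∃ (n : ℕ) (X : ℕ → Subcomplex Z), X 0 = X₀ ∧ (X n).toTiledSurface.BoundaryReduced ∧
        (X n).toTiledSurface.IsCompact ∧
        ∀ i < n, (X i).Step (X (i + 1)) ∧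
          (X (i + 1)).toTiledSurface.boundaryLength + 2 ≤ (X i).toTiledSurface.boundaryLength := by
  induction N using Nat.strong_induction_on with
  | _ N ih =>
    intro X₀ hc hN
    by_cases hbr : X₀.toTiledSurface.BoundaryReduced
    · exact ⟨0, fun _ => X₀, rfl, hbr, hc, by simp⟩
    · obtain ⟨X₁, hs⟩ := exists_step hbr
      have hlt := hs.boundaryLength_add_two_le hg hZ hc
      obtain ⟨n, X, h0, hn, hcn, hi⟩ := ih (N - 1) (by omega) X₁ (hs.isCompact hc) (by omega)
      refine ⟨n + 1, fun i => Nat.casesOn i X₀ X, rfl, hn, hcn, ?_⟩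
      rintro (_ | i) h
      · exact ⟨by simpa [h0] using hs, by simpa [h0] using hlt⟩
      · exact hi i (by omega)

end Subcomplex

theorem Hom.isCompact_range {Y : TiledSurface.{u} g} {Z : TiledSurface.{v} g} (φ : Hom Y Z)
    (hY : Y.IsCompact) : φ.range.toTiledSurface.IsCompact := by
  obtain ⟨h1, h2, h3⟩ := hY
  exact ⟨Set.finite_range φ.onV, Set.finite_range φ.onE, Set.finite_range φ.onF⟩

/-- The boundary reduced closure of a compact tiled surface is reached by finitely many steps. -/
theorem Hom.exists_steps_brClosure (hg : 2 ≤ g) {Y : TiledSurface.{u} g} {Z : TiledSurface.{v} g}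
    (φ : Hom Y Z) (hY : Y.IsCompact) (hZ : Z.BoundaryReduced) :
    φ.brClosure.toTiledSurface.IsCompact ∧
      ∃ (n : ℕ) (X : ℕ → Subcomplex Z), X 0 = φ.range ∧ X n = φ.brClosure ∧
        ∀ i < n, (X i).Step (X (i + 1)) ∧
          (X (i + 1)).toTiledSurface.boundaryLength + 2 ≤
            (X i).toTiledSurface.boundaryLength := by
  obtain ⟨n, X, h0, hbr, hc, hs⟩ := Subcomplex.exists_steps hg hZ _ φ.range
    (φ.isCompact_range hY) le_rfl
  -- Every stage lies below all boundary reduced `W` containing the image; the final stage is itself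
  -- such a `W`, hence equals their intersection.
  have hle : ∀ i ≤ n, φ.range ≤ X i ∧ ∀ W : Subcomplex Z, φ.range ≤ W →
      W.toTiledSurface.BoundaryReduced → X i ≤ W := by
    intro i
    induction i with
    | zero => exact fun _ => h0 ▸ ⟨Subcomplex.le_refl _, fun W h _ => h⟩
    | succ i ih =>
      intro hi
      have hst := (hs i (by omega)).1
      obtain ⟨h1, h2⟩ := ih (by omega)
      exact ⟨Subcomplex.le_trans h1 hst.le,
        fun W h hW => hst.le_of_boundaryReduced (by omega) (h2 W h hW) hW⟩
  have heq : X n = φ.brClosure := by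
    obtain ⟨h1, h2⟩ := hle n le_rfl
    refine Subcomplex.le_antisymm ⟨?_, ?_, ?_⟩ ⟨?_, ?_, ?_⟩
    · exact fun v hv W hW => (h2 W hW.1 hW.2).1 hv
    · exact fun v hv W hW => (h2 W hW.1 hW.2).2.1 hv
    · exact fun v hv W hW => (h2 W hW.1 hW.2).2.2 hv
    · exact fun v hv => hv (X n) ⟨h1, hbr⟩
    · exact fun v hv => hv (X n) ⟨h1, hbr⟩
    · exact fun v hv => hv (X n) ⟨h1, hbr⟩
  exact ⟨heq ▸ hc, n, X, h0, heq, hs⟩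

end TiledSurface

namespace TiledSurface

/-! ### A compact tiled surface with a non-compact strongly boundary reduced closure -/

namespace IntegerCover

/-- The homomorphism `a_1, b_2 ↦ 1`, `b_1, a_2 ↦ -1` to the integers, on generators. -/
def shift : SurfaceGen 2 → ℤ
  | .a 0 => 1
  | .b 0 => -1
  | .a 1 => -1
  | .b 1 => 1

/-- The signed value of `shift` on a letter. -/
def letterShift (x : Letter 2) : ℤ := if x.2 then shift x.1 else -shift x.1

/-- The homomorphism from the surface group of genus two to the integers given by `shift`. -/
def shiftHom : SurfaceGroup 2 →* Multiplicative ℤ :=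
  PresentedGroup.toGroup (f := fun x => Multiplicative.ofAdd (shift x)) (by
    rintro r rfl
    rfl)

theorem shiftHom_wordValue (w : List (Letter 2)) :
    (shiftHom (wordValue w)).toAdd = (w.map letterShift).sum := by
  induction w with
  | nil => exact congrArg Multiplicative.toAdd (map_one shiftHom)
  | cons x w ih =>
    have h : wordValue (x :: w) = wordValue [x] * wordValue w := by
      rw [wordValue, wordValue, wordValue, ← map_mul, FreeGroup.mul_mk]
      rfl
    have hx : (shiftHom (wordValue [x])).toAdd = letterShift x := by
      change (FreeGroup.lift (fun x => Multiplicative.ofAdd (shift x))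
        (FreeGroup.mk [x])).toAdd = _
      rcases x with ⟨i, _ | _⟩ <;> simp [FreeGroup.lift_mk, letterShift]
    rw [h, map_mul, toAdd_mul, ih, hx, List.map_cons, List.sum_cons]

/-- The attaching path of the octagon that starts at `n`. -/
def octagon (n : ℤ) : List ((ℤ × SurfaceGen 2) × Bool) :=
  [((n, .a 0), true), ((n + 1, .b 0), true), ((n - 1, .a 0), false), ((n, .b 0), false),
    ((n, .a 1), true), ((n - 1, .b 1), true), ((n + 1, .a 1), false), ((n, .b 1), false)]

/-- Each dart changes the integer vertex by the shift of its letter. As this sum factors through the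
surface group, P2 follows for the cover. -/
theorem dartTgt_getLast (p : List ((ℤ × SurfaceGen 2) × Bool))
    (d : (ℤ × SurfaceGen 2) × Bool)
    (hp : LabeledGraph.IsPath (fun e : ℤ × SurfaceGen 2 => e.1) (fun e => e.1 + shift e.2) (d :: p)) :
    LabeledGraph.dartTgt (fun e : ℤ × SurfaceGen 2 => e.1) (fun e => e.1 + shift e.2)
        ((d :: p).getLast (by simp)) =
      LabeledGraph.dartSrc (fun e : ℤ × SurfaceGen 2 => e.1) (fun e => e.1 + shift e.2) d +
        (((d :: p).map (LabeledGraph.dartLetter fun e : ℤ × SurfaceGen 2 => e.2)).map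
          letterShift).sum := by
  have h1 : ∀ d : (ℤ × SurfaceGen 2) × Bool,
      LabeledGraph.dartTgt (fun e : ℤ × SurfaceGen 2 => e.1) (fun e => e.1 + shift e.2) d =
      LabeledGraph.dartSrc (fun e : ℤ × SurfaceGen 2 => e.1) (fun e => e.1 + shift e.2) d +
        letterShift (LabeledGraph.dartLetter (fun e : ℤ × SurfaceGen 2 => e.2) d) := by
    rintro ⟨e, _ | _⟩ <;>
      simp [LabeledGraph.dartTgt, LabeledGraph.dartSrc, LabeledGraph.dartLetter, letterShift]
  induction p generalizing d with
  | nil => simpa using h1 d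
  | cons d' p ih =>
    obtain ⟨hd, hp'⟩ := List.isChain_cons_cons.1 hp
    rw [List.getLast_cons_cons, ih d' hp', ← hd, h1, List.map_cons, List.map_cons, List.sum_cons]
    simp only [List.map_cons, List.sum_cons]
    ring

/-- The infinite cyclic covering of the surface of genus two that belongs to `shiftHom`. -/
def surface : TiledSurface.{0} 2 where
  V := ℤ
  E := ℤ × SurfaceGen 2
  F := ℤ
  src e := e.1
  tgt e := e.1 + shift e.2
  label e := e.2
  bdry := octagon
  out_unique e e' h h' := Prod.ext h h'
  in_unique e e' h h' := by
    refine Prod.ext ?_ h'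
    rw [h'] at h
    exact add_right_cancel h
  closed_of_trivial p hp hw := by
    cases p with
    | nil => rfl
    | cons d p =>
      have h := dartTgt_getLast p d hp
      rw [← shiftHom_wordValue, hw, map_one, toAdd_one, add_zero] at h
      rw [LabeledGraph.IsClosed, List.head?_cons, List.getLast?_eq_some_getLast (by simp),
        Option.map_some, Option.map_some, h]
  bdry_isPath n := by
    simp [LabeledGraph.IsPath, octagon, LabeledGraph.dartTgt, LabeledGraph.dartSrc, shift,
      sub_eq_add_neg]
  bdry_isClosed n := by
    simp [LabeledGraph.IsClosed, octagon, LabeledGraph.dartTgt, LabeledGraph.dartSrc, shift]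
  bdry_word n := rfl
  bdry_injective n n' h := by
    have := congrArg (fun l => l.head?.map fun d => d.1.1) h
    simpa [octagon] using this

theorem exists_leftOf (d : surface.Dart) : ∃ f, surface.LeftOf f d := by
  obtain ⟨⟨n, i⟩, s⟩ := d
  have key : ∃ m : ℤ, ((n, i), s) ∈ octagon m := by
    rcases i with i | i <;> fin_cases i <;> cases s
    · exact ⟨n + 1, by simp [octagon]⟩
    · exact ⟨n, by simp [octagon]⟩
    · exact ⟨n - 1, by simp [octagon]⟩
    · exact ⟨n, by simp [octagon]⟩
    · exact ⟨n, by simp [octagon]⟩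
    · exact ⟨n - 1, by simp [octagon]⟩
    · exact ⟨n, by simp [octagon]⟩
    · exact ⟨n + 1, by simp [octagon]⟩
  exact key

/-- The cover has an octagon on both sides of every edge, so its boundary is empty. -/
theorem stronglyBoundaryReduced : surface.StronglyBoundaryReduced := by
  have h : ∀ p, p ≠ [] → ¬ surface.IsBoundaryPath p := fun p hp hb => by
    obtain ⟨d, hd⟩ := List.exists_mem_of_ne_nil p hp
    obtain ⟨f, hf⟩ := exists_leftOf d
    exact hb.1 d hd f hf
  exact ⟨fun p hb hp => h p hp.1.1 hb, fun p hb _ => h p hb.1 hb.2.1⟩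

/-- The sub-complex that consists of one closed octagon. -/
def closedOctagon : Subcomplex surface :=
  Subcomplex.adjoin ⟨∅, ∅, ∅, by simp, by simp, by simp⟩ {(0 : ℤ)}

theorem isCompact_closedOctagon : closedOctagon.toTiledSurface.IsCompact :=
  Subcomplex.isCompact_adjoin ((Subcomplex.isCompact_iff _).2 (by simp)) (Set.finite_singleton _)

/-- A strongly boundary reduced sub-complex that contains one octagon contains the next one: they
share a half-block. -/
theorem succ_mem_faces {X : Subcomplex surface} (hX : X.toTiledSurface.StronglyBoundaryReduced)
    {n : ℤ} (hn : n ∈ X.faces) : (n + 1 : ℤ) ∈ X.faces := by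
  by_contra hn'
  have hedge : ∀ d ∈ octagon n, d.1 ∈ X.edges := X.bdry_mem n hn
  -- These are the sides `a_1⁻¹, b_1⁻¹, a_2, b_2` of octagon `n + 1`, consecutive in the relator.
  -- Reversed, all four are sides of octagon `n`, so their edges lie in `X`, and without octagon `n
  -- + 1` they form a half-block on the boundary.
  let p : List X.toTiledSurface.Dart :=
    [(⟨(n, .a 0), hedge ((n, .a 0), true) (by simp [octagon])⟩, false),
      (⟨(n + 1, .b 0), hedge ((n + 1, .b 0), true) (by simp [octagon])⟩, false),
      (⟨(n + 1, .a 1), hedge ((n + 1, .a 1), false) (by simp [octagon])⟩, true),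
      (⟨(n, .b 1), hedge ((n, .b 1), false) (by simp [octagon])⟩, true)]
  have hleft : ∀ d ∈ p, surface.LeftOf (n + 1 : ℤ) (X.toAmbient d) := by
    have h : [((n, .a 0), false), ((n + 1, .b 0), false), ((n + 1, .a 1), true),
        ((n, .b 1), true)] ⊆ octagon (n + 1) := by simp [octagon]
    exact fun d hd => h (List.mem_map_of_mem (f := X.incl.onDart) hd)
  have hblock : X.toTiledSurface.IsBlock p := by
    rw [isBlock_iff]
    refine ⟨by simp [p], ?_⟩
    simp only [p, List.isChain_cons_cons, List.isChain_singleton, and_true]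
    refine ⟨⟨Subtype.ext ?_, rfl⟩, ⟨Subtype.ext ?_, rfl⟩, ⟨Subtype.ext ?_, rfl⟩⟩
    · change (n : ℤ) = n + 1 + -1
      ring
    · rfl
    · change (n + 1 + -1 : ℤ) = n
      ring
  refine hX.1 p (hblock.isBoundaryPath fun d hd f hf => hn' ?_) ⟨hblock, rfl⟩
  rw [(hleft d hd).face_unique (X.leftOf_iff.1 hf)]
  exact f.2

theorem not_isCompact_sbrClosure : ¬ closedOctagon.incl.sbrClosure.toTiledSurface.IsCompact := by
  intro h
  have hmem : ∀ n : ℕ, ((n : ℤ) : surface.F) ∈ closedOctagon.incl.sbrClosure.faces := by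
    intro n X hX
    induction n with
    | zero => exact hX.1.2.2 ⟨⟨(0 : ℤ), Or.inr rfl⟩, rfl⟩
    | succ n ih =>
      rw [Nat.cast_succ]
      exact succ_mem_faces hX.2 ih
  have hinf : (Set.range fun n : ℕ => (n : ℤ)).Infinite :=
    Set.infinite_range_of_injective Nat.cast_injective
  refine hinf (((Subcomplex.isCompact_iff _).1 h).2.2.subset ?_)
  rintro _ ⟨n, rfl⟩
  exact hmem n

end IntegerCover

end TiledSurface
theorem proposition4p4 :
    (∀ (g : ℕ), 2 ≤ g → ∀ (Y : TiledSurface.{u} g) (Z : TiledSurface.{v} g)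
      (φ : TiledSurface.Hom Y Z), φ.IsEmbedding → Y.IsCompact → Z.BoundaryReduced →
      φ.brClosure.toTiledSurface.IsCompact ∧
      ∃ (n : ℕ) (X : ℕ → TiledSurface.Subcomplex Z),
        X 0 = φ.range ∧ X n = φ.brClosure ∧
        ∀ i < n, (X i).Step (X (i + 1)) ∧
          (X (i + 1)).toTiledSurface.boundaryLength + 2 ≤
            (X i).toTiledSurface.boundaryLength) ∧
    (∃ (Y Z : TiledSurface.{0} 2) (φ : TiledSurface.Hom Y Z), φ.IsEmbedding ∧ Y.IsCompact ∧
      Z.StronglyBoundaryReduced ∧ ¬ φ.sbrClosure.toTiledSurface.IsCompact) := by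

  refine ⟨fun g hg Y Z φ _ hY hZ => φ.exists_steps_brClosure hg hY hZ, ?_⟩
  refine ⟨_, _, TiledSurface.IntegerCover.closedOctagon.incl,
    ⟨Subtype.val_injective, Subtype.val_injective, Subtype.val_injective⟩,
    TiledSurface.IntegerCover.isCompact_closedOctagon,
    TiledSurface.IntegerCover.stronglyBoundaryReduced,
    TiledSurface.IntegerCover.not_isCompact_sbrClosure⟩
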